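/- Two polynomials $F,G\in\mathbb C[x,y,z]$ are called equivalent if $G(\mathbf x)=F(A\mathbf x)$ for some $A\in GL(3,\mathbb C)$. The symmetry group of $F$ is $G_F=\{B\in GL(3,\mathbb C): F(B\mathbf x)=F(\mathbf x)\}$; its elements are the genuine symmetries of $F$. The projective symmetry group $\Gamma_F=\pi(G_F)$ is the image of $G_F$ under the projection $\pi$ from $GL(3,\mathbb C)$ onto its quotient by the scalar matrices. A form of degree $3$ is described by its inhomogeneous version $f(p,q)=F(p,q,1)$, and is called singular if its zero set $V\subset\mathbb{CP}^2$ has a point at which all three partial derivatives of $F$ vanish, nonsingular otherwise. **Theorem (irreducible ternary cubics).** Let $F\in\mathbb C[x,y,z]$ be an irreducible homogeneous polynomial of degree $3$. 1. $F$ is singular if and only if it is equivalent to one of the following two cubics. - (a) The cusp $p^3-q^2$. The symmetry group is then one-dimensional. More precisely, let $D$ be the group of the matrices $\mathrm{diag}(1,\alpha,\alpha^{-2})$, $\alpha\in\mathbb C^*$. If $F(A\mathbf x)=x^3-y^2z$ with $A\in GL(3,\mathbb C)$, then $\Gamma_F=\pi(ADA^{-1})$ and $G_F=\{\omega\,A d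 A^{-1} : \omega^3=1,\ d\in D\}$. - (b) The node $p^2(p+1)-q^2$. There are then exactly $6$ projective symmetries and exactly $18$ genuine symmetries. 2. $F$ is nonsingular if and only if it is equivalent to one of the following cubics. - (a) A member of the one-parameter family $p^3+ap+1-q^2$ with $a\neq 0$ and $4a^3+27\neq 0$. There are then exactly $18$ projective symmetries. - (b) $p^3+p-q^2$. There are then exactly $36$ projective symmetries. - (c) $p^3+1-q^2$. There are then exactly $54$ projective symmetries. The cubic $p^3+q^3+1$ is equivalent to $p^3+1-q^2$. -/

import Mathlib

open MvPolynomial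

noncomputable section

namespace TernaryCubic

/-- Complex polynomials in the three variables `x = X 0`, `y = X 1`, `z = X 2`.
The inhomogeneous version of a form `F` is `f(p, q) = F(p, q, 1)`. -/
abbrev Poly : Type := MvPolynomial (Fin 3) ℂ

/-- The linear change of variables: `linSubst A F` is the polynomial `F(A x)`. -/
def linSubst (A : Matrix (Fin 3) (Fin 3) ℂ) (F : Poly) : Poly :=
  bind₁ (fun i => ∑ j, C (A i j) * X j) F

theorem linSubst_one (F : Poly) : linSubst 1 F = F := by
  have h : (fun i : Fin 3 => ∑ j, C ((1 : Matrix (Fin 3) (Fin 3) ℂ) i j) * X j)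
      = (X : Fin 3 → Poly) := by
    funext i
    simp [Matrix.one_apply]
  rw [linSubst, h, bind₁_X_left, AlgHom.id_apply]

theorem linSubst_mul (A B : Matrix (Fin 3) (Fin 3) ℂ) (F : Poly) :
    linSubst (A * B) F = linSubst B (linSubst A F) := by
  rw [linSubst, linSubst, linSubst, bind₁_bind₁]
  congr 2
  funext i
  simp only [map_sum, map_mul, bind₁_C_right, bind₁_X_right, Matrix.mul_apply, Finset.sum_mul,
    Finset.mul_sum]
  rw [Finset.sum_comm]
  simp only [mul_assoc]

/-- `F` is equivalent to `G` if `G(x) = F(A x)` for some invertible `A`. -/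
def Equivalent (F G : Poly) : Prop :=
  ∃ A : GL (Fin 3) ℂ, G = linSubst (A : Matrix (Fin 3) (Fin 3) ℂ) F

/-- The (genuine) symmetry group of `F`: all invertible linear transformations that map `F`
to itself. -/
def symmetryGroup (F : Poly) : Subgroup (GL (Fin 3) ℂ) where
  carrier := {A | linSubst (A : Matrix (Fin 3) (Fin 3) ℂ) F = F}
  one_mem' := linSubst_one F
  mul_mem' := by
    intro A B hA hB
    simp only [Set.mem_ofPred_eq] at hA hB ⊢
    rw [Units.val_mul, linSubst_mul, hA, hB]
  inv_mem' := by
    intro A hA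
    simp only [Set.mem_ofPred_eq] at hA ⊢
    calc linSubst ((A⁻¹ : GL (Fin 3) ℂ) : Matrix (Fin 3) (Fin 3) ℂ) F
        = linSubst ((A⁻¹ : GL (Fin 3) ℂ) : Matrix (Fin 3) (Fin 3) ℂ)
            (linSubst (A : Matrix (Fin 3) (Fin 3) ℂ) F) := by rw [hA]
      _ = F := by rw [← linSubst_mul, Units.mul_inv, linSubst_one]

/-- The projection of `GL(3, ℂ)` onto its quotient by the scalar matrices
(the center of `GL(3, ℂ)`). -/
def projection : GL (Fin 3) ℂ →* GL (Fin 3) ℂ ⧸ Subgroup.center (GL (Fin 3) ℂ) :=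
  QuotientGroup.mk' (Subgroup.center (GL (Fin 3) ℂ))

/-- The projective symmetry group of `F`: the image of its symmetry group in `PGL(3, ℂ)`. -/
def projectiveSymmetryGroup (F : Poly) :
    Subgroup (GL (Fin 3) ℂ ⧸ Subgroup.center (GL (Fin 3) ℂ)) :=
  (symmetryGroup F).map projection

/-- The complex dimension of the symmetry group of `F`, i.e. of its Lie algebra, which consists
of the matrices `X` whose one-parameter group `exp (t X)` preserves `F`. -/
def symmetryDim (F : Poly) : ℕ :=
  Module.finrank ℂ (Submodule.span ℂ
    {X : Matrix (Fin 3) (Fin 3) ℂ | ∀ t : ℂ, linSubst (NormedSpace.exp (t • X)) F = F})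

/-- The zero set of `F` in the complex projective plane has a singular point. -/
def IsSingular (F : Poly) : Prop :=
  ∃ v : Fin 3 → ℂ, v ≠ 0 ∧ eval v F = 0 ∧ ∀ i, eval v (pderiv i F) = 0

/-- The form with inhomogeneous version `p ^ 3 - q ^ 2`. -/
def cusp : Poly := X 0 ^ 3 - X 1 ^ 2 * X 2

/-- The form with inhomogeneous version `p ^ 2 * (p + 1) - q ^ 2`. -/
def node : Poly := X 0 ^ 2 * (X 0 + X 2) - X 1 ^ 2 * X 2

/-- The form with inhomogeneous version `p ^ 3 + a * p + b - q ^ 2`. -/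
def weierstrass (a b : ℂ) : Poly :=
  X 0 ^ 3 + C a * X 0 * X 2 ^ 2 + C b * X 2 ^ 3 - X 1 ^ 2 * X 2

/-- The form with inhomogeneous version `p ^ 3 + q ^ 3 + 1`. -/
def fermat : Poly := X 0 ^ 3 + X 1 ^ 3 + X 2 ^ 3

/-- The one-parameter group of the diagonal matrices `diag (1, α, 1 / α ^ 2)`. -/
def cuspGroup : Subgroup (GL (Fin 3) ℂ) where
  carrier := {D | ∃ α : ℂ, α ≠ 0 ∧
    (D : Matrix (Fin 3) (Fin 3) ℂ) = Matrix.diagonal ![1, α, 1 / α ^ 2]}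
  one_mem' := ⟨1, one_ne_zero, by
    ext i j
    fin_cases i <;> fin_cases j <;> simp⟩
  mul_mem' := by
    rintro D E ⟨α, hα, hD⟩ ⟨β, hβ, hE⟩
    refine ⟨α * β, mul_ne_zero hα hβ, ?_⟩
    rw [Units.val_mul, hD, hE, Matrix.diagonal_mul_diagonal]
    congr 1
    funext i
    fin_cases i <;> simp [mul_pow, mul_comm]
  inv_mem' := by
    rintro D ⟨α, hα, hD⟩
    refine ⟨α⁻¹, inv_ne_zero hα, ?_⟩
    refine Units.inv_eq_of_mul_eq_one_right ?_
    rw [hD, Matrix.diagonal_mul_diagonal]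
    ext i j
    fin_cases i <;> fin_cases j <;> simp [hα]

end TernaryCubic

end

noncomputable section

namespace TernaryCubic

/-! ### Linear substitutions -/

/-! Singular case. With a singular point at (0:0:1) the cubic is z q(x,y) + k(x,y), where the binary
quadratic q is the tangent cone. If q = 0, the binary cubic k has a linear factor and F is
reducible. If q has two distinct factors they become x and y, z absorbs the middle terms of k, and
scaling gives x^3 + y^3 + xyz, which is the node. If q is a nonzero square it becomes a multiple of
y^2, and completing the cube gives the cusp.

Nonsingular case. F and its Hessian determinant have a common zero (`exists_common_zero`), which is
a flex (`exists_isFlexLine`). With the flex at (0:1:0) and its tangent at z = 0, completing the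
square in y and the cube in x gives a Weierstrass form, and scaling leaves the three types.

Symmetries. The scalars in G_F are the cube roots of unity, so |G_F| = 3 |Γ_F|
(`card_symmetryGroup_eq`). A symmetry of the cusp or node fixes the singular point, and comparing
coefficients then determines the matrix. For a Weierstrass cubic, the harmonic reflections at flexes
make the action on the nine flexes transitive, and the stabilizer of the flex at infinity is
diagonal, of order 6, 12 or 18. Hence |G_F| is 9 times and |Γ_F| is 3 times that order
(`card_symmetryGroup_weierstrass`). -/

theorem eval_linSubst (A : Matrix (Fin 3) (Fin 3) ℂ) (F : Poly) (v : Fin 3 → ℂ) :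
    eval v (linSubst A F) = eval (A.mulVec v) F := by
  rw [linSubst, ← coe_aeval_eq_eval, RingHom.coe_coe, aeval_bind₁, ← coe_aeval_eq_eval,
    RingHom.coe_coe]
  congr 2
  funext i
  simp [Matrix.mulVec, dotProduct]

theorem poly_ext {F G : Poly} (h : ∀ x y z : ℂ, eval ![x, y, z] F = eval ![x, y, z] G) :
    F = G := by
  refine MvPolynomial.funext fun v => ?_
  have hv : v = ![v 0, v 1, v 2] := by
    ext i
    fin_cases i <;> rfl
  rw [hv]
  exact h _ _ _

theorem linSubst_eq_iff {A : Matrix (Fin 3) (Fin 3) ℂ} {F G : Poly} :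
    linSubst A F = G ↔
      ∀ x y z : ℂ, eval (A.mulVec ![x, y, z]) F = eval ![x, y, z] G := by
  constructor
  · rintro rfl x y z
    rw [eval_linSubst]
  · intro h
    refine poly_ext fun x y z => ?_
    rw [eval_linSubst, h]

theorem Equivalent.trans {F G H : Poly} (h₁ : Equivalent F G) (h₂ : Equivalent G H) :
    Equivalent F H := by
  obtain ⟨A, rfl⟩ := h₁
  obtain ⟨B, rfl⟩ := h₂
  exact ⟨A * B, by rw [Units.val_mul, linSubst_mul]⟩

theorem linSubst_inv_linSubst (A : GL (Fin 3) ℂ) (F : Poly) :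
    linSubst ((A⁻¹ : GL (Fin 3) ℂ) : Matrix (Fin 3) (Fin 3) ℂ)
      (linSubst (A : Matrix (Fin 3) (Fin 3) ℂ) F) = F := by
  rw [← linSubst_mul, Units.mul_inv, linSubst_one]

theorem Equivalent.symm {F G : Poly} (h : Equivalent F G) : Equivalent G F := by
  obtain ⟨A, rfl⟩ := h
  exact ⟨A⁻¹, (linSubst_inv_linSubst A F).symm⟩

/-- The linear substitution of an invertible matrix, as an automorphism of the polynomial ring. -/
def linSubstEquiv (A : GL (Fin 3) ℂ) : Poly ≃* Poly where
  toFun := linSubst (A : Matrix (Fin 3) (Fin 3) ℂ)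
  invFun := linSubst ((A⁻¹ : GL (Fin 3) ℂ) : Matrix (Fin 3) (Fin 3) ℂ)
  left_inv := linSubst_inv_linSubst A
  right_inv F := by simpa using linSubst_inv_linSubst A⁻¹ F
  map_mul' F G := by simp [linSubst]

theorem Equivalent.irreducible {F G : Poly} (h : Equivalent F G) (hF : Irreducible F) :
    Irreducible G := by
  obtain ⟨A, rfl⟩ := h
  exact (MulEquiv.irreducible_iff (linSubstEquiv A)).2 hF

theorem Equivalent.isHomogeneous {F G : Poly} (h : Equivalent F G) {n : ℕ}
    (hF : F.IsHomogeneous n) : G.IsHomogeneous n := by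
  obtain ⟨A, rfl⟩ := h
  have := hF.aeval (fun i => ∑ j, C ((A : Matrix (Fin 3) (Fin 3) ℂ) i j) * X j) (n := 1)
    (fun i => IsHomogeneous.sum _ _ _ fun j _ => by
      simpa using (isHomogeneous_C (Fin 3) _).mul (isHomogeneous_X ℂ j))
  simpa [linSubst] using this

theorem equivalent_of_det_ne_zero {F G : Poly} (A : Matrix (Fin 3) (Fin 3) ℂ) (hA : A.det ≠ 0)
    (h : ∀ x y z : ℂ, eval (A.mulVec ![x, y, z]) F = eval ![x, y, z] G) : Equivalent F G :=
  ⟨Matrix.GeneralLinearGroup.mkOfDetNeZero A hA, (linSubst_eq_iff.2 h).symm⟩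

/-- A unit is a nonzero constant, so it cannot vanish at the origin. This turns every visible
factorization below into a contradiction with irreducibility. -/
theorem not_irreducible_mul {P Q : Poly} (hP : eval 0 P = 0) (hQ : eval 0 Q = 0) :
    ¬ Irreducible (P * Q) := by
  intro h
  have key : ∀ R : Poly, eval 0 R = 0 → ¬ IsUnit R := fun R hR hu => by
    have := hu.map (eval (0 : Fin 3 → ℂ))
    rw [hR] at this
    exact not_isUnit_zero this
  exact (h.isUnit_or_isUnit rfl).elim (key P hP) (key Q hQ)

theorem pderiv_linSubst (A : Matrix (Fin 3) (Fin 3) ℂ) (F : Poly) (j : Fin 3) :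
    pderiv j (linSubst A F) = ∑ i, C (A i j) * linSubst A (pderiv i F) := by
  induction F using MvPolynomial.induction_on with
  | C a => simp [linSubst]
  | add p q hp hq =>
    have : linSubst A (p + q) = linSubst A p + linSubst A q := by simp [linSubst]
    rw [this, map_add, hp, hq, ← Finset.sum_add_distrib]
    refine Finset.sum_congr rfl fun i _ => ?_
    simp [linSubst, mul_add]
  | mul_X p k hp =>
    have : linSubst A (p * X k) = linSubst A p * ∑ j, C (A k j) * X j := by simp [linSubst]
    rw [this, pderiv_mul, hp]
    have h1 : pderiv j (∑ l, C (A k l) * (X l : Poly)) = C (A k j) := by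
      simp [pderiv_X, Pi.single_apply]
    have h2 : ∀ i, linSubst A (pderiv i (p * X k)) =
        linSubst A (pderiv i p) * (∑ j, C (A k j) * X j) +
          linSubst A p * (if k = i then 1 else 0) := by
      intro i
      simp only [pderiv_mul, pderiv_X, Pi.single_apply, linSubst, map_add, map_mul, bind₁_X_right]
      split_ifs <;> simp
    simp only [h1, h2, mul_add, Finset.sum_add_distrib, Finset.sum_mul]
    congr 1
    · exact Finset.sum_congr rfl fun i _ => by ring
    · simp [mul_comm]

theorem Equivalent.isSingular {F G : Poly} (h : Equivalent F G) (hG : IsSingular G) :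
    IsSingular F := by
  obtain ⟨A, rfl⟩ := h.symm
  obtain ⟨v, hv, h0, h1⟩ := hG
  refine ⟨((A⁻¹ : GL (Fin 3) ℂ) : Matrix (Fin 3) (Fin 3) ℂ).mulVec v, ?_, ?_, ?_⟩
  · intro h
    apply hv
    have := congrArg (A : Matrix (Fin 3) (Fin 3) ℂ).mulVec h
    rwa [Matrix.mulVec_mulVec, Units.mul_inv, Matrix.one_mulVec, Matrix.mulVec_zero] at this
  · rw [eval_linSubst, Matrix.mulVec_mulVec, Units.mul_inv, Matrix.one_mulVec, h0]
  · intro j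
    rw [pderiv_linSubst, map_sum]
    refine Finset.sum_eq_zero fun i _ => ?_
    rw [map_mul, eval_linSubst, Matrix.mulVec_mulVec, Units.mul_inv, Matrix.one_mulVec, h1,
      mul_zero]

/-! ### Explicit ternary cubics -/

/-- The ternary cubic with the given coefficients. -/
def cubic (c : Fin 10 → ℂ) : Poly :=
  C (c 0) * X 0 ^ 3 + C (c 1) * X 0 ^ 2 * X 1 + C (c 2) * X 0 ^ 2 * X 2 + C (c 3) * X 0 * X 1 ^ 2 +
    C (c 4) * X 0 * X 1 * X 2 + C (c 5) * X 0 * X 2 ^ 2 + C (c 6) * X 1 ^ 3 +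
    C (c 7) * X 1 ^ 2 * X 2 + C (c 8) * X 1 * X 2 ^ 2 + C (c 9) * X 2 ^ 3

theorem eval_cubic (c : Fin 10 → ℂ) (v : Fin 3 → ℂ) :
    eval v (cubic c) = c 0 * v 0 ^ 3 + c 1 * v 0 ^ 2 * v 1 + c 2 * v 0 ^ 2 * v 2 +
      c 3 * v 0 * v 1 ^ 2 + c 4 * v 0 * v 1 * v 2 + c 5 * v 0 * v 2 ^ 2 + c 6 * v 1 ^ 3 +
      c 7 * v 1 ^ 2 * v 2 + c 8 * v 1 * v 2 ^ 2 + c 9 * v 2 ^ 3 := by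
  simp [cubic]

theorem exists_eq_cubic {F : Poly} (hF : F.IsHomogeneous 3) : ∃ c, F = cubic c := by
  rw [F.as_sum]
  refine Finset.sum_induction _ (fun G => ∃ c, G = cubic c) ?_ ⟨0, by simp [cubic]⟩ ?_
  · rintro _ _ ⟨c, rfl⟩ ⟨d, rfl⟩
    refine ⟨c + d, ?_⟩
    simp only [cubic, Pi.add_apply, map_add]
    ring
  · intro d hd
    have hdeg : d 0 + d 1 + d 2 = 3 := by
      have := hF (mem_support_iff.1 hd)
      rw [Finsupp.weight_apply, Finsupp.sum_fintype _ _ (by simp)] at this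
      simpa [Fin.sum_univ_three] using this
    generalize coeff d F = a
    have hmon : monomial d a = C a * (X 0 ^ d 0 * X 1 ^ d 1 * X 2 ^ d 2) := by
      rw [monomial_eq, Finsupp.prod_fintype _ _ (by simp), Fin.prod_univ_three]
    rw [hmon]
    generalize d 0 = i at *
    generalize d 1 = j at *
    generalize d 2 = k at *
    have hi : i ≤ 3 := by omega
    have hj : j ≤ 3 := by omega
    obtain rfl : k = 3 - i - j := by omega
    interval_cases i <;> interval_cases j <;> first | omega | skip
    · exact ⟨Pi.single 9 a, by simp [cubic]⟩
    · exact ⟨Pi.single 8 a, by simp [cubic]; ring⟩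
    · exact ⟨Pi.single 7 a, by simp [cubic]; ring⟩
    · exact ⟨Pi.single 6 a, by simp [cubic]⟩
    · exact ⟨Pi.single 5 a, by simp [cubic]; ring⟩
    · exact ⟨Pi.single 4 a, by simp [cubic]; ring⟩
    · exact ⟨Pi.single 3 a, by simp [cubic]; ring⟩
    · exact ⟨Pi.single 2 a, by simp [cubic]; ring⟩
    · exact ⟨Pi.single 1 a, by simp [cubic]; ring⟩
    · exact ⟨Pi.single 0 a, by simp [cubic]⟩

/-- Points with coordinates 0, 1, -1 suffice, because a sign change separates odd from even terms.
This is the tool for comparing coefficients in all the symmetry computations. -/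
theorem coeff_eq_zero_of_forall_eval {c₀ c₁ c₂ c₃ c₄ c₅ c₆ c₇ c₈ c₉ : ℂ}
    (h : ∀ x y z : ℂ, c₀ * x ^ 3 + c₁ * x ^ 2 * y + c₂ * x ^ 2 * z + c₃ * x * y ^ 2 +
      c₄ * x * y * z + c₅ * x * z ^ 2 + c₆ * y ^ 3 + c₇ * y ^ 2 * z + c₈ * y * z ^ 2 +
      c₉ * z ^ 3 = 0) :
    c₀ = 0 ∧ c₁ = 0 ∧ c₂ = 0 ∧ c₃ = 0 ∧ c₄ = 0 ∧ c₅ = 0 ∧ c₆ = 0 ∧ c₇ = 0 ∧ c₈ = 0 ∧ c₉ = 0 := by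
  have h0 : c₀ = 0 := by simpa using h 1 0 0
  have h6 : c₆ = 0 := by simpa using h 0 1 0
  have h9 : c₉ = 0 := by simpa using h 0 0 1
  subst h0 h6 h9
  have h1 : c₁ = 0 := by linear_combination (h 1 1 0 - h 1 (-1) 0) / 2
  have h3 : c₃ = 0 := by linear_combination (h 1 1 0 + h 1 (-1) 0) / 2
  have h2 : c₂ = 0 := by linear_combination (h 1 0 1 - h 1 0 (-1)) / 2
  have h5 : c₅ = 0 := by linear_combination (h 1 0 1 + h 1 0 (-1)) / 2
  have h7 : c₇ = 0 := by linear_combination (h 0 1 1 - h 0 1 (-1)) / 2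
  have h8 : c₈ = 0 := by linear_combination (h 0 1 1 + h 0 1 (-1)) / 2
  subst h1 h3 h2 h5 h7 h8
  have h4 : c₄ = 0 := by simpa using h 1 1 1
  simp [h4]

/-! ### Two plane curves through the origin of affine space meet elsewhere -/

/-- The substitution of zero for the first `k` variables. -/
def killVars (k : ℕ) : Poly →ₐ[ℂ] Poly := aeval fun i : Fin 3 => if (i : ℕ) < k then 0 else X i

theorem killVars_comp (k : ℕ) : (killVars (k + 1)).comp (killVars k) = killVars (k + 1) := by
  refine algHom_ext fun i => ?_
  simp only [killVars, AlgHom.comp_apply, aeval_X]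
  split_ifs with h1 h2 h2
  · simp
  · omega
  · simp [Nat.lt_succ_iff.1 h2]
  · simp [mt Nat.lt_succ_iff.2 h2]

/-- The kernels are the primes 0, (x), (x, y), (x, y, z); each inclusion is strict because one more
variable enters. -/
theorem le_height_ker_killVars (k : ℕ) (hk : k ≤ 3) :
    (k : ℕ∞) ≤ (RingHom.ker (killVars k)).height := by
  induction k with
  | zero => simp
  | succ k ih =>
    have h1 : (RingHom.ker (killVars k)).IsPrime := RingHom.ker_isPrime _
    have h2 : (RingHom.ker (killVars (k + 1))).IsPrime := RingHom.ker_isPrime _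
    have hlt : RingHom.ker (killVars k) < RingHom.ker (killVars (k + 1)) := by
      refine lt_of_le_of_ne (fun p hp => ?_) fun h => ?_
      · rw [RingHom.mem_ker] at hp ⊢
        rw [← killVars_comp, AlgHom.comp_apply, hp, map_zero]
      · have h3 : (X ⟨k, hk⟩ : Poly) ∈ RingHom.ker (killVars (k + 1)) := by
          simp [RingHom.mem_ker, killVars]
        rw [← h, RingHom.mem_ker] at h3
        simp [killVars] at h3
    have := Ideal.height_add_one_le_of_lt_of_isPrime hlt
    push_cast
    exact (add_le_add_left (ih (by omega)) 1).trans this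

/-- If the origin were the only common zero, the Nullstellensatz would make (x, y, z) the radical of
(F, G), hence a minimal prime over it. Krull's height theorem bounds its height by 2, but the height
is at least 3. -/
theorem exists_common_zero {F G : Poly} (hF : eval 0 F = 0) (hG : eval 0 G = 0) :
    ∃ v : Fin 3 → ℂ, v ≠ 0 ∧ eval v F = 0 ∧ eval v G = 0 := by
  by_contra! hcon
  have hev : ∀ (v : Fin 3 → ℂ) (p : Poly), aeval v p = eval v p := fun v p => by
    rw [← coe_aeval_eq_eval, RingHom.coe_coe]
  have hI : zeroLocus ℂ (Ideal.span {F, G}) = {0} := by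
    ext v
    simp only [zeroLocus_span, Set.mem_singleton_iff]
    constructor
    · intro h
      by_contra hv
      refine hcon v hv ?_ ?_
      · rw [← hev, h F (by simp)]
      · rw [← hev, h G (by simp)]
    · rintro rfl p hp
      rcases hp with rfl | hp
      · rw [hev, hF]
      · rw [Set.mem_singleton_iff] at hp
        subst hp
        rw [hev, hG]
  have hrad := vanishingIdeal_zeroLocus_eq_radical (k := ℂ) (K := ℂ) (Ideal.span {F, G})
  rw [hI] at hrad
  have hker : RingHom.ker (killVars 3) = vanishingIdeal ℂ {(0 : Fin 3 → ℂ)} := by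
    ext p
    have : (killVars 3) = (Algebra.ofId ℂ Poly).comp (aeval (0 : Fin 3 → ℂ)) := by
      refine algHom_ext fun i => ?_
      simp [killVars]
    rw [RingHom.mem_ker, this, mem_vanishingIdeal_singleton_iff]
    simp [Algebra.ofId_apply]
  have hprime : (RingHom.ker (killVars 3)).IsPrime := RingHom.ker_isPrime _
  have hmin : RingHom.ker (killVars 3) ∈ (Ideal.span {F, G}).minimalPrimes := by
    rw [← Ideal.radical_minimalPrimes, ← hrad, ← hker, Ideal.minimalPrimes_eq_subsingleton_self]
    rfl
  have h1 := Ideal.height_le_card_of_mem_minimalPrimes_span (Set.toFinite _) hmin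
  have h2 := (le_height_ker_killVars 3 le_rfl).trans h1
  have h3 : ({F, G} : Set Poly).ncard ≤ 2 := (Set.ncard_insert_le F {G}).trans (by simp)
  have h4 : 3 ≤ ({F, G} : Set Poly).ncard := by exact_mod_cast h2
  omega

/-! ### Normal forms of singular cubics -/

theorem mulVec_three (a b c d e f g h i x y z : ℂ) :
    (!![a, b, c; d, e, f; g, h, i] : Matrix (Fin 3) (Fin 3) ℂ).mulVec ![x, y, z] =
      ![a * x + b * y + c * z, d * x + e * y + f * z, g * x + h * y + i * z] := by
  ext k
  fin_cases k <;> simp [Matrix.mulVec, dotProduct, Fin.sum_univ_three]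

theorem eval_cubic_vec (c : Fin 10 → ℂ) (x y z : ℂ) :
    eval ![x, y, z] (cubic c) = c 0 * x ^ 3 + c 1 * x ^ 2 * y + c 2 * x ^ 2 * z +
      c 3 * x * y ^ 2 + c 4 * x * y * z + c 5 * x * z ^ 2 + c 6 * y ^ 3 +
      c 7 * y ^ 2 * z + c 8 * y * z ^ 2 + c 9 * z ^ 3 := by
  simp [eval_cubic]

theorem eval_cubic_mk (c₀ c₁ c₂ c₃ c₄ c₅ c₆ c₇ c₈ c₉ x y z : ℂ) :
    eval ![x, y, z] (cubic ![c₀, c₁, c₂, c₃, c₄, c₅, c₆, c₇, c₈, c₉]) =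
      c₀ * x ^ 3 + c₁ * x ^ 2 * y + c₂ * x ^ 2 * z + c₃ * x * y ^ 2 + c₄ * x * y * z +
      c₅ * x * z ^ 2 + c₆ * y ^ 3 + c₇ * y ^ 2 * z + c₈ * y * z ^ 2 + c₉ * z ^ 3 :=
  eval_cubic_vec _ x y z

theorem pderiv_two (i : Fin 3) : pderiv i (2 : Poly) = 0 :=
  Derivation.map_natCast _ 2

theorem pderiv_three (i : Fin 3) : pderiv i (3 : Poly) = 0 :=
  Derivation.map_natCast _ 3

theorem eval_weierstrass (a b x y z : ℂ) :
    eval ![x, y, z] (weierstrass a b) = x ^ 3 + a * x * z ^ 2 + b * z ^ 3 - y ^ 2 * z := by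
  simp [weierstrass]

theorem exists_mulVec_eq {v : Fin 3 → ℂ} (hv : v ≠ 0) :
    ∃ A : GL (Fin 3) ℂ, (A : Matrix (Fin 3) (Fin 3) ℂ).mulVec ![0, 0, 1] = v := by
  have key : ∃ A : Matrix (Fin 3) (Fin 3) ℂ, A.det ≠ 0 ∧ A.mulVec ![0, 0, 1] = v := by
    by_cases h2 : v 2 = 0
    · by_cases h1 : v 1 = 0
      · by_cases h0 : v 0 = 0
        · exact absurd (_root_.funext fun i => by fin_cases i <;> assumption) hv
        · refine ⟨!![0, 0, v 0; 1, 0, v 1; 0, 1, v 2], by simpa [Matrix.det_fin_three] using h0, ?_⟩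
          rw [mulVec_three]
          ext i
          fin_cases i <;> simp
      · refine ⟨!![1, 0, v 0; 0, 0, v 1; 0, 1, v 2], by simpa [Matrix.det_fin_three] using h1, ?_⟩
        rw [mulVec_three]
        ext i
        fin_cases i <;> simp
    · refine ⟨!![1, 0, v 0; 0, 1, v 1; 0, 0, v 2], by simpa [Matrix.det_fin_three] using h2, ?_⟩
      rw [mulVec_three]
      ext i
      fin_cases i <;> simp
  obtain ⟨A, hA, h⟩ := key
  exact ⟨Matrix.GeneralLinearGroup.mkOfDetNeZero A hA, h⟩

/-- At (0,0,1) the three partial derivatives of `cubic c` are c 5, c 8 and 3 c 9. -/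
theorem exists_equivalent_cubic_of_isSingular {F : Poly} (hF : F.IsHomogeneous 3)
    (hs : IsSingular F) : ∃ c, Equivalent F (cubic c) ∧ c 5 = 0 ∧ c 8 = 0 ∧ c 9 = 0 := by
  obtain ⟨v, hv, h0, h1⟩ := hs
  obtain ⟨A, rfl⟩ := exists_mulVec_eq hv
  have hE : Equivalent F (linSubst (A : Matrix (Fin 3) (Fin 3) ℂ) F) := ⟨A, rfl⟩
  obtain ⟨c, hc⟩ := exists_eq_cubic (hE.isHomogeneous hF)
  have hd : ∀ j, eval ![0, 0, 1] (pderiv j (cubic c)) = 0 := by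
    intro j
    rw [← hc, pderiv_linSubst, map_sum]
    refine Finset.sum_eq_zero fun i _ => ?_
    rw [map_mul, eval_linSubst, h1, mul_zero]
  refine ⟨c, hc ▸ hE, ?_, ?_, ?_⟩
  · simpa [cubic, pderiv_X, Pi.single_apply] using hd 0
  · simpa [cubic, pderiv_X, Pi.single_apply] using hd 1
  · simpa [cubic, pderiv_X, Pi.single_apply] using hd 2

/-- This splits the tangent cone α x^2 + β xy + γ y^2 as (px + qy)(rx + sy), the two tangents at the
singular point. -/
theorem exists_linear_factors (α β γ : ℂ) :
    ∃ p q r s : ℂ, α = p * r ∧ β = p * s + q * r ∧ γ = q * s := by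
  by_cases hα : α = 0
  · exact ⟨0, 1, β, γ, by simp [hα], by simp, by simp⟩
  · obtain ⟨d, hd⟩ := IsAlgClosed.exists_pow_nat_eq (β ^ 2 - 4 * α * γ) (n := 2) (by norm_num)
    refine ⟨α, (β - d) / 2, 1, (β + d) / (2 * α), by ring, by field_simp; ring, ?_⟩
    field_simp
    linear_combination hd

theorem not_irreducible_binary (a b c d : ℂ) :
    ¬ Irreducible (cubic ![a, b, 0, c, 0, 0, d, 0, 0, 0]) := by
  by_cases hd : d = 0
  · have : cubic ![a, b, 0, c, 0, 0, d, 0, 0, 0] =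
        X 0 * (C a * X 0 ^ 2 + C b * X 0 * X 1 + C c * X 1 ^ 2) := by
      simp [cubic, hd]
      ring
    rw [this]
    exact not_irreducible_mul (by simp) (by simp)
  · obtain ⟨t, ht⟩ := IsAlgClosed.exists_root
      (Polynomial.C d * Polynomial.X ^ 3 + Polynomial.C c * Polynomial.X ^ 2 +
        Polynomial.C b * Polynomial.X + Polynomial.C a)
      (by rw [Polynomial.degree_cubic hd]; norm_num)
    have ht : d * t ^ 3 + c * t ^ 2 + b * t + a = 0 := by simpa using ht
    have : cubic ![a, b, 0, c, 0, 0, d, 0, 0, 0] =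
        (X 1 - C t * X 0) * (C d * X 1 ^ 2 + C (c + d * t) * X 0 * X 1 +
          C (b + c * t + d * t ^ 2) * X 0 ^ 2) := by
      refine poly_ext fun x y z => ?_
      rw [eval_cubic_vec]
      simp
      linear_combination x ^ 3 * ht
    rw [this]
    exact not_irreducible_mul (by simp) (by simp)

/-- The hypotheses say that the tangent cone is l u^2 + m uv + n v^2 with u = px + qy and v = rx +
sy. Taking u, v as coordinates brings it to prescribed coefficients and only changes the binary
cubic part. -/
theorem exists_equivalent_of_quadratic {c : Fin 10 → ℂ} (h5 : c 5 = 0) (h8 : c 8 = 0)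
    (h9 : c 9 = 0) {p q r s l m n : ℂ} (hD : p * s - q * r ≠ 0)
    (h2 : c 2 = l * p ^ 2 + m * p * r + n * r ^ 2)
    (h4 : c 4 = 2 * l * p * q + m * (p * s + q * r) + 2 * n * r * s)
    (h7 : c 7 = l * q ^ 2 + m * q * s + n * s ^ 2) :
    ∃ a b d e : ℂ, Equivalent (cubic c) (cubic ![a, b, l, d, m, 0, e, n, 0, 0]) := by
  obtain ⟨D, hDD⟩ : ∃ D, D * (p * s - q * r) = 1 := ⟨_, inv_mul_cancel₀ hD⟩
  have hD0 : D ≠ 0 := left_ne_zero_of_mul_eq_one hDD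
  -- S, Q, R, P are the entries of the inverse of the matrix with rows (p, q) and (r, s).
  obtain ⟨S, hS⟩ : ∃ S, S = s * D := ⟨_, rfl⟩
  obtain ⟨Q, hQ⟩ : ∃ Q, Q = -q * D := ⟨_, rfl⟩
  obtain ⟨R, hR⟩ : ∃ R, R = -r * D := ⟨_, rfl⟩
  obtain ⟨P, hP⟩ : ∃ P, P = p * D := ⟨_, rfl⟩
  refine ⟨c 0 * S ^ 3 + c 1 * S ^ 2 * R + c 3 * S * R ^ 2 + c 6 * R ^ 3,
    3 * c 0 * S ^ 2 * Q + c 1 * (S ^ 2 * P + 2 * S * Q * R) + c 3 * (2 * S * R * P + Q * R ^ 2) +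
      3 * c 6 * R ^ 2 * P,
    3 * c 0 * S * Q ^ 2 + c 1 * (2 * S * Q * P + Q ^ 2 * R) + c 3 * (S * P ^ 2 + 2 * Q * R * P) +
      3 * c 6 * R * P ^ 2,
    c 0 * Q ^ 3 + c 1 * Q ^ 2 * P + c 3 * Q * P ^ 2 + c 6 * P ^ 3,
    equivalent_of_det_ne_zero !![S, Q, 0; R, P, 0; 0, 0, 1] ?_ fun x y z => ?_⟩
  · have : S * P - Q * R = D := by
      rw [hS, hP, hQ, hR]
      linear_combination D * hDD
    simpa [Matrix.det_fin_three, this] using hD0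
  · have hx : p * (S * x + Q * y) + q * (R * x + P * y) = x := by
      rw [hS, hP, hQ, hR]
      linear_combination x * hDD
    have hy : r * (S * x + Q * y) + s * (R * x + P * y) = y := by
      rw [hS, hP, hQ, hR]
      linear_combination y * hDD
    have hz : c 2 * (S * x + Q * y) ^ 2 + c 4 * (S * x + Q * y) * (R * x + P * y) +
        c 7 * (R * x + P * y) ^ 2 = l * x ^ 2 + m * x * y + n * y ^ 2 := by
      rw [h2, h4, h7]
      generalize S * x + Q * y = u at *
      generalize R * x + P * y = v at *
      rw [← hx, ← hy]
      ring
    rw [mulVec_three, eval_cubic_vec, eval_cubic_mk, h5, h8, h9]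
    linear_combination z * hz

/-- The nodal cubic, in coordinates in which the tangents of the node are coordinate axes. -/
def nodeAxes : Poly := X 0 ^ 3 + X 1 ^ 3 + X 0 * X 1 * X 2

theorem eval_nodeAxes (x y z : ℂ) :
    eval ![x, y, z] nodeAxes = x ^ 3 + y ^ 3 + x * y * z := by
  simp [nodeAxes]

/-- The first two rows turn xy into (x^2 - y^2)/4; the entry 3 cancels the xy^2 term left by the sum
of cubes. -/
theorem nodeAxes_equivalent_node : Equivalent nodeAxes node := by
  refine equivalent_of_det_ne_zero !![1 / 2, -1 / 2, 0; 1 / 2, 1 / 2, 0; 3, 0, 4] ?_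
    fun x y z => ?_
  · rw [Matrix.det_fin_three]
    simp
    norm_num
  · rw [mulVec_three, eval_nodeAxes]
    simp [node]
    ring

/-- The terms b x^2 y + d x y^2 are divisible by xy, so a shift of z removes them. Irreducibility
makes a and e nonzero, and they are scaled to 1. -/
theorem equivalent_nodeAxes {a b d e : ℂ}
    (hirr : Irreducible (cubic ![a, b, 0, d, 1, 0, e, 0, 0, 0])) :
    Equivalent (cubic ![a, b, 0, d, 1, 0, e, 0, 0, 0]) nodeAxes := by
  have ha : a ≠ 0 := by
    rintro rfl
    have : cubic ![0, b, 0, d, 1, 0, e, 0, 0, 0] =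
        X 1 * (C b * X 0 ^ 2 + C d * X 0 * X 1 + X 0 * X 2 + C e * X 1 ^ 2) := by
      simp [cubic]
      ring
    exact not_irreducible_mul (by simp) (by simp) (this ▸ hirr)
  have he : e ≠ 0 := by
    rintro rfl
    have : cubic ![a, b, 0, d, 1, 0, 0, 0, 0, 0] =
        X 0 * (C a * X 0 ^ 2 + C b * X 0 * X 1 + C d * X 1 ^ 2 + X 1 * X 2) := by
      simp [cubic]
      ring
    exact not_irreducible_mul (by simp) (by simp) (this ▸ hirr)
  obtain ⟨s, hs⟩ := IsAlgClosed.exists_pow_nat_eq a⁻¹ (n := 3) (by norm_num)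
  obtain ⟨t, ht⟩ := IsAlgClosed.exists_pow_nat_eq e⁻¹ (n := 3) (by norm_num)
  have hs0 : s ≠ 0 := by
    rintro rfl
    exact inv_ne_zero ha (by simpa using hs.symm)
  have ht0 : t ≠ 0 := by
    rintro rfl
    exact inv_ne_zero he (by simpa using ht.symm)
  have hs' : a * s ^ 3 = 1 := by rw [hs, mul_inv_cancel₀ ha]
  have ht' : e * t ^ 3 = 1 := by rw [ht, mul_inv_cancel₀ he]
  refine equivalent_of_det_ne_zero !![s, 0, 0; 0, t, 0; -b * s, -d * t, 1 / (s * t)] ?_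
    fun x y z => ?_
  · simp [Matrix.det_fin_three, hs0, ht0]
  · rw [mulVec_three, eval_nodeAxes, eval_cubic_vec]
    simp
    field_simp
    linear_combination x ^ 3 * hs' + y ^ 3 * ht'

theorem eval_cusp (x y z : ℂ) : eval ![x, y, z] cusp = x ^ 3 - y ^ 2 * z := by
  simp [cusp]

/-- The shift u of x completes the cube and kills x^2 y. What remains beyond x^3 is divisible by y^2
and is absorbed into z. -/
theorem equivalent_cusp {a b d e k : ℂ} (hk : k ≠ 0)
    (hirr : Irreducible (cubic ![a, b, 0, d, 0, 0, e, k, 0, 0])) :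
    Equivalent (cubic ![a, b, 0, d, 0, 0, e, k, 0, 0]) cusp := by
  have ha : a ≠ 0 := by
    rintro rfl
    have : cubic ![0, b, 0, d, 0, 0, e, k, 0, 0] =
        X 1 * (C b * X 0 ^ 2 + C d * X 0 * X 1 + C e * X 1 ^ 2 + C k * X 1 * X 2) := by
      simp [cubic]
      ring
    exact not_irreducible_mul (by simp) (by simp) (this ▸ hirr)
  obtain ⟨t, rfl⟩ := IsAlgClosed.exists_pow_nat_eq a (n := 3) (by norm_num)
  have ht : t ≠ 0 := by
    rintro rfl
    simp at ha
  obtain ⟨u, hu⟩ : ∃ u, u = -b / (3 * t ^ 3) := ⟨_, rfl⟩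
  have hb : b = -3 * t ^ 3 * u := by
    rw [hu]
    field_simp
  subst hb
  refine equivalent_of_det_ne_zero !![1 / t, u, 0; 0, 1, 0;
    (3 * t ^ 2 * u ^ 2 - d / t) / k, (2 * t ^ 3 * u ^ 3 - d * u - e) / k, -1 / k] ?_
    fun x y z => ?_
  · simp [Matrix.det_fin_three, ht, hk]
  · rw [mulVec_three, eval_cusp, eval_cubic_vec]
    simp
    field_simp
    ring

theorem equivalent_cusp_or_node {F : Poly} (hF : F.IsHomogeneous 3) (hirr : Irreducible F)
    (hs : IsSingular F) : Equivalent F cusp ∨ Equivalent F node := by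
  obtain ⟨c, hE, h5, h8, h9⟩ := exists_equivalent_cubic_of_isSingular hF hs
  have hc := hE.irreducible hirr
  obtain ⟨p, q, r, s, h2, h4, h7⟩ := exists_linear_factors (c 2) (c 4) (c 7)
  by_cases hD : p * s - q * r = 0
  · left
    by_cases hp : p = 0 ∧ q = 0
    · exfalso
      obtain ⟨rfl, rfl⟩ := hp
      have : cubic c = cubic ![c 0, c 1, 0, c 3, 0, 0, c 6, 0, 0, 0] := by
        simp [cubic, h2, h4, h5, h7, h8, h9]
      exact not_irreducible_binary _ _ _ _ (this ▸ hc)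
    obtain ⟨k, rfl, rfl⟩ : ∃ k, r = k * p ∧ s = k * q := by
      by_cases hp0 : p = 0
      · have hq : q ≠ 0 := fun h => hp ⟨hp0, h⟩
        refine ⟨s / q, ?_, by field_simp⟩
        subst hp0
        simpa [hq] using hD
      · refine ⟨r / p, by field_simp, ?_⟩
        field_simp
        linear_combination hD
    have hk : k ≠ 0 := by
      rintro rfl
      have : cubic c = cubic ![c 0, c 1, 0, c 3, 0, 0, c 6, 0, 0, 0] := by
        simp [cubic, h2, h4, h5, h7, h8, h9]
      exact not_irreducible_binary _ _ _ _ (this ▸ hc)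
    -- The tangent cone is now k (px + qy)^2; a second linear form completes px + qy to a basis,
    -- with px + qy as the new y.
    obtain ⟨r', s', hD'⟩ : ∃ r' s' : ℂ, r' * q - s' * p ≠ 0 := by
      by_cases hp0 : p = 0
      · exact ⟨1, 0, by simpa using fun h => hp ⟨hp0, h⟩⟩
      · exact ⟨0, 1, by simpa using hp0⟩
    obtain ⟨a, b, d, e, hE'⟩ := exists_equivalent_of_quadratic h5 h8 h9 (l := 0) (m := 0) (n := k)
      hD' (by rw [h2]; ring) (by rw [h4]; ring) (by rw [h7]; ring)
    exact (hE.trans hE').trans (equivalent_cusp hk (hE'.irreducible hc))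
  · right
    obtain ⟨a, b, d, e, hE'⟩ := exists_equivalent_of_quadratic h5 h8 h9 (l := 0) (m := 1) (n := 0)
      hD (by rw [h2]; ring) (by rw [h4]; ring) (by rw [h7]; ring)
    exact ((hE.trans hE').trans (equivalent_nodeAxes (hE'.irreducible hc))).trans
      nodeAxes_equivalent_node

theorem isSingular_cusp : IsSingular cusp :=
  ⟨![0, 0, 1], fun h => by simpa using congrFun h 2, by simp [cusp], fun i => by
    fin_cases i <;> simp [cusp, pderiv_X]⟩

theorem isSingular_node : IsSingular node :=
  ⟨![0, 0, 1], fun h => by simpa using congrFun h 2, by simp [node], fun i => by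
    fin_cases i <;> simp [node, pderiv_X]⟩

/-! ### Normal forms of nonsingular cubics -/

/-- On the line joining `v` and `w`, the form `F` vanishes only at `v`, or everywhere. -/
def IsFlexLine (F : Poly) (v w : Fin 3 → ℂ) : Prop :=
  v ≠ 0 ∧ (∀ k : ℂ, w ≠ k • v) ∧ ∀ s t : ℂ, eval (s • v + t • w) F = t ^ 3 * eval w F

/-- Let M be the Hessian matrix at v, a common zero of F and det M, and let Mw = 0 with w nonzero.
In F(sv + tw) the coefficient of s^2 t is v·Mw/2 and that of s t^2 is w·Mw/2, so only t^3 F(w)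
survives. If w were a multiple of v, Euler's identity Mv = 2 ∇F(v) would make v singular. -/
theorem exists_isFlexLine {F : Poly} (hF : F.IsHomogeneous 3) (hs : ¬ IsSingular F) :
    ∃ v w, IsFlexLine F v w := by
  obtain ⟨c, rfl⟩ := exists_eq_cubic hF
  obtain ⟨v, hv, h0, hdet⟩ := exists_common_zero (F := cubic c)
    (G := (Matrix.of fun i j => pderiv i (pderiv j (cubic c))).det) (by simp [cubic])
    (by
      rw [Matrix.det_fin_three]
      simp [cubic, pderiv_X, Pi.single_apply])
  have hdet' : (Matrix.of fun i j => eval v (pderiv i (pderiv j (cubic c)))).det = 0 := by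
    rw [← hdet, RingHom.map_det]
    rfl
  obtain ⟨w, hw, hMw⟩ := Matrix.exists_mulVec_eq_zero_iff.2 hdet'
  have e0 := congrFun hMw 0
  have e1 := congrFun hMw 1
  have e2 := congrFun hMw 2
  simp [Matrix.mulVec, dotProduct, Fin.sum_univ_three, cubic, pderiv_X, Pi.single_apply,
    pderiv_two,
    pderiv_three] at e0 e1 e2
  rw [eval_cubic] at h0
  refine ⟨v, w, hv, ?_, fun s t => ?_⟩
  · rintro k rfl
    have hk : k ≠ 0 := by
      rintro rfl
      simp at hw
    apply hs
    simp only [Pi.smul_apply, smul_eq_mul] at e0 e1 e2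
    refine ⟨v, hv, by rw [eval_cubic, h0], fun i => ?_⟩
    have h2k : 2 * k ≠ 0 := mul_ne_zero two_ne_zero hk
    fin_cases i
    · simp [cubic, pderiv_X]
      refine mul_left_cancel₀ h2k ?_
      linear_combination e0
    · simp [cubic, pderiv_X]
      refine mul_left_cancel₀ h2k ?_
      linear_combination e1
    · simp [cubic, pderiv_X]
      refine mul_left_cancel₀ h2k ?_
      linear_combination e2
  · rw [eval_cubic, eval_cubic]
    simp only [Pi.add_apply, Pi.smul_apply, smul_eq_mul]
    linear_combination s ^ 3 * h0 + (s ^ 2 * t * v 0 + s * t ^ 2 * w 0) / 2 * e0 +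
      (s ^ 2 * t * v 1 + s * t ^ 2 * w 1) / 2 * e1 + (s ^ 2 * t * v 2 + s * t ^ 2 * w 2) / 2 * e2

/-- With u running over the standard basis, vanishing determinants say that the cross product of v
and w is zero. -/
theorem exists_det_ne_zero {v w : Fin 3 → ℂ} (hv : v ≠ 0) (hw : ∀ k : ℂ, w ≠ k • v) :
    ∃ u : Fin 3 → ℂ, !![w 0, v 0, u 0; w 1, v 1, u 1; w 2, v 2, u 2].det ≠ 0 := by
  by_contra! h
  have h0 := h ![1, 0, 0]
  have h1 := h ![0, 1, 0]
  have h2 := h ![0, 0, 1]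
  simp [Matrix.det_fin_three] at h0 h1 h2
  by_cases hv0 : v 0 = 0
  · by_cases hv1 : v 1 = 0
    · have hv2 : v 2 ≠ 0 := fun hv2 => hv (funext fun i => by fin_cases i <;> assumption)
      refine hw (w 2 / v 2) (funext fun i => ?_)
      fin_cases i
      · simp
        field_simp
        linear_combination -h1
      · simp
        field_simp
        linear_combination h0
      · simp
        field_simp
    · refine hw (w 1 / v 1) (funext fun i => ?_)
      fin_cases i
      · simp
        field_simp
        linear_combination h2
      · simp
        field_simp
      · simp
        field_simp
        linear_combination -h0
  · refine hw (w 0 / v 0) (funext fun i => ?_)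
    fin_cases i
    · simp
      field_simp
    · simp
      field_simp
      linear_combination -h2
    · simp
      field_simp
      linear_combination h1

/-- In the basis w, v, u the flex is (0,1,0) and the flex line is z = 0, on which the cubic
restricts to a multiple of x^3. -/
theorem IsFlexLine.exists_equivalent {F : Poly} (hF : F.IsHomogeneous 3) {v w : Fin 3 → ℂ}
    (h : IsFlexLine F v w) :
    ∃ c, Equivalent F (cubic c) ∧ c 1 = 0 ∧ c 3 = 0 ∧ c 6 = 0 := by
  obtain ⟨hv, hw, h⟩ := h
  obtain ⟨u, hu⟩ := exists_det_ne_zero hv hw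
  have hE : Equivalent F (linSubst !![w 0, v 0, u 0; w 1, v 1, u 1; w 2, v 2, u 2] F) :=
    ⟨Matrix.GeneralLinearGroup.mkOfDetNeZero _ hu, rfl⟩
  obtain ⟨c, hc⟩ := exists_eq_cubic (hE.isHomogeneous hF)
  rw [hc] at hE
  have key : ∀ x y : ℂ, eval ![x, y, 0] (cubic c) = x ^ 3 * eval w F := by
    intro x y
    rw [← hc, eval_linSubst, mulVec_three, ← h y x]
    congr 2
    funext i
    fin_cases i <;> simp <;> ring
  simp only [eval_cubic_vec] at key
  have h6 : c 6 = 0 := by simpa using key 0 1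
  refine ⟨c, hE, ?_, ?_, h6⟩
  · linear_combination (key 1 1 - key 1 (-1)) / 2 - h6
  · linear_combination (key 1 1 + key 1 (-1)) / 2 - key 1 0

/-- If c 0 = 0 then z divides the cubic, and if c 7 = 0 then (0,1,0) is singular. Otherwise both
squares and cubes can be completed. -/
theorem exists_equivalent_weierstrass {c : Fin 10 → ℂ} (h1 : c 1 = 0) (h3 : c 3 = 0)
    (h6 : c 6 = 0) (hirr : Irreducible (cubic c)) (hs : ¬ IsSingular (cubic c)) :
    ∃ a b, Equivalent (cubic c) (weierstrass a b) := by
  have h0 : c 0 ≠ 0 := by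
    intro h0
    have : cubic c = X 2 * (C (c 2) * X 0 ^ 2 + C (c 4) * X 0 * X 1 + C (c 5) * X 0 * X 2 +
        C (c 7) * X 1 ^ 2 + C (c 8) * X 1 * X 2 + C (c 9) * X 2 ^ 2) := by
      simp [cubic, h0, h1, h3, h6]
      ring
    exact not_irreducible_mul (by simp) (by simp) (this ▸ hirr)
  have h7 : c 7 ≠ 0 := by
    intro h7
    refine hs ⟨![0, 1, 0], fun h => by simpa using congrFun h 1, ?_, fun i => ?_⟩
    · simp [eval_cubic_vec, h6]
    · fin_cases i <;> simp [cubic, pderiv_X, h3, h6, h7]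
  obtain ⟨t, ht⟩ := IsAlgClosed.exists_pow_nat_eq (c 0)⁻¹ (n := 3) (by norm_num)
  have ht' : c 0 * t ^ 3 = 1 := by rw [ht, mul_inv_cancel₀ h0]
  obtain ⟨k, hk⟩ := IsAlgClosed.exists_pow_nat_eq (-(c 7)⁻¹) (n := 2) (by norm_num)
  have hk' : c 7 * k ^ 2 = -1 := by rw [hk, mul_neg, mul_inv_cancel₀ h7]
  -- Completing the square in y subtracts g (c 4 x + c 8 z)^2 z; e is the shift of x that then kills
  -- x^2 z, while t and k normalize the coefficients of x^3 and y^2 z.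
  obtain ⟨g, hg⟩ : ∃ g, 4 * g * c 7 = 1 := ⟨1 / (4 * c 7), by field_simp⟩
  obtain ⟨e, he⟩ : ∃ e, 3 * c 0 * e + (c 2 - g * c 4 ^ 2) = 0 :=
    ⟨-(c 2 - g * c 4 ^ 2) / (3 * c 0), by field_simp; ring⟩
  refine ⟨t * (3 * c 0 * e ^ 2 + 2 * (c 2 - g * c 4 ^ 2) * e + (c 5 - 2 * g * c 4 * c 8)),
    c 0 * e ^ 3 + (c 2 - g * c 4 ^ 2) * e ^ 2 + (c 5 - 2 * g * c 4 * c 8) * e +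
      (c 9 - g * c 8 ^ 2),
    equivalent_of_det_ne_zero
      !![t, 0, e; -2 * g * c 4 * t, k, -2 * g * (c 4 * e + c 8); 0, 0, 1] ?_ fun x y z => ?_⟩
  · have ht0 : t ≠ 0 := by
      rintro rfl
      simp at ht'
    have hk0 : k ≠ 0 := by
      rintro rfl
      simp at hk'
    simp [Matrix.det_fin_three, ht0, hk0]
  · rw [mulVec_three, eval_weierstrass, eval_cubic_vec, h1, h3, h6]
    linear_combination x ^ 3 * ht' + x ^ 2 * z * t ^ 2 * he + z * y ^ 2 * hk' +
      z * (g * (c 4 * (t * x + e * z) + c 8 * z) ^ 2 -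
        k * y * (c 4 * (t * x + e * z) + c 8 * z)) * hg

theorem isSingular_weierstrass {a b : ℂ} (h : 4 * a ^ 3 + 27 * b ^ 2 = 0) :
    IsSingular (weierstrass a b) := by
  by_cases ha : a = 0
  · have hb : b = 0 := by simpa [ha] using h
    refine ⟨![0, 0, 1], fun h => by simpa using congrFun h 2, ?_, fun i => ?_⟩
    · simp [eval_weierstrass, hb]
    · fin_cases i <;> simp [weierstrass, pderiv_X, ha, hb]
  -- The double root of x^3 + ax + b is -3b/(2a), and it gives the singular point (x:0:1).
  · obtain ⟨x, rfl⟩ : ∃ x, b = -2 * a * x / 3 := ⟨-3 * b / (2 * a), by field_simp⟩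
    have hx : 3 * x ^ 2 + a = 0 := by
      have : 4 * a ^ 2 * (3 * x ^ 2 + a) = 0 := by linear_combination h
      simpa [ha] using this
    refine ⟨![x, 0, 1], fun h => by simpa using congrFun h 2, ?_, fun i => ?_⟩
    · rw [eval_weierstrass]
      linear_combination x / 3 * hx
    · fin_cases i <;> simp [weierstrass, pderiv_X]
      · linear_combination hx
      · ring

theorem not_isSingular_weierstrass {a b : ℂ} (h : 4 * a ^ 3 + 27 * b ^ 2 ≠ 0) :
    ¬ IsSingular (weierstrass a b) := by
  rintro ⟨v, hv, -, hd⟩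
  have d0 := hd 0
  have d1 := hd 1
  have d2 := hd 2
  simp [weierstrass, pderiv_X] at d0 d1 d2
  by_cases hz : v 2 = 0
  · have hx : v 0 = 0 := by simpa [hz] using d0
    have hy : v 1 = 0 := by simpa [hz] using d2
    exact hv (funext fun i => by fin_cases i <;> assumption)
  · have hy : v 1 = 0 := by simpa [hz] using d1
    rw [hy] at d2
    have e : 2 * a * v 0 + 3 * b * v 2 = 0 := by
      refine mul_left_cancel₀ hz ?_
      linear_combination d2
    apply h
    refine mul_left_cancel₀ (pow_ne_zero 2 hz) ?_
    linear_combination 4 * a ^ 2 * d0 - (6 * a * v 0 - 9 * b * v 2) * e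

/-- Scaling y by μ and z by ν preserves x^3 - y^2 z when μ^2 ν = 1; it multiplies a by ν^2 and b by
ν^3. -/
theorem weierstrass_equivalent_one {a b : ℂ} (hb : b ≠ 0) :
    ∃ ν : ℂ, b * ν ^ 3 = 1 ∧ Equivalent (weierstrass a b) (weierstrass (a * ν ^ 2) 1) := by
  obtain ⟨ν, hν⟩ := IsAlgClosed.exists_pow_nat_eq b⁻¹ (n := 3) (by norm_num)
  have hν' : b * ν ^ 3 = 1 := by rw [hν, mul_inv_cancel₀ hb]
  have hν0 : ν ≠ 0 := by
    rintro rfl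
    simp at hν'
  obtain ⟨μ, hμ⟩ := IsAlgClosed.exists_pow_nat_eq ν⁻¹ (n := 2) (by norm_num)
  have hμ' : μ ^ 2 * ν = 1 := by rw [hμ, inv_mul_cancel₀ hν0]
  have hμ0 : μ ≠ 0 := by
    rintro rfl
    simp at hμ'
  refine ⟨ν, hν', equivalent_of_det_ne_zero !![1, 0, 0; 0, μ, 0; 0, 0, ν] ?_ fun x y z => ?_⟩
  · simp [Matrix.det_fin_three, hμ0, hν0]
  · rw [mulVec_three, eval_weierstrass, eval_weierstrass]
    linear_combination z ^ 3 * hν' - y ^ 2 * z * hμ'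

theorem weierstrass_equivalent_one_zero {a : ℂ} (ha : a ≠ 0) :
    Equivalent (weierstrass a 0) (weierstrass 1 0) := by
  obtain ⟨ν, hν⟩ := IsAlgClosed.exists_pow_nat_eq a⁻¹ (n := 2) (by norm_num)
  have hν' : a * ν ^ 2 = 1 := by rw [hν, mul_inv_cancel₀ ha]
  have hν0 : ν ≠ 0 := by
    rintro rfl
    simp at hν'
  obtain ⟨μ, hμ⟩ := IsAlgClosed.exists_pow_nat_eq ν⁻¹ (n := 2) (by norm_num)
  have hμ' : μ ^ 2 * ν = 1 := by rw [hμ, inv_mul_cancel₀ hν0]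
  have hμ0 : μ ≠ 0 := by
    rintro rfl
    simp at hμ'
  refine equivalent_of_det_ne_zero !![1, 0, 0; 0, μ, 0; 0, 0, ν] ?_ fun x y z => ?_
  · simp [Matrix.det_fin_three, hμ0, hν0]
  · rw [mulVec_three, eval_weierstrass, eval_weierstrass]
    linear_combination x * z ^ 2 * hν' - y ^ 2 * z * hμ'

theorem equivalent_weierstrass {F : Poly} (hF : F.IsHomogeneous 3) (hirr : Irreducible F)
    (hs : ¬ IsSingular F) :
    (∃ a : ℂ, a ≠ 0 ∧ 4 * a ^ 3 + 27 ≠ 0 ∧ Equivalent F (weierstrass a 1)) ∨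
      Equivalent F (weierstrass 1 0) ∨ Equivalent F (weierstrass 0 1) := by
  obtain ⟨v, w, hvw⟩ := exists_isFlexLine hF hs
  obtain ⟨c, hE, h1, h3, h6⟩ := hvw.exists_equivalent hF
  obtain ⟨a, b, hE'⟩ := exists_equivalent_weierstrass h1 h3 h6 (hE.irreducible hirr)
    (mt hE.isSingular hs)
  have hW := hE.trans hE'
  have hdisc : 4 * a ^ 3 + 27 * b ^ 2 ≠ 0 := fun h => hs (hW.isSingular (isSingular_weierstrass h))
  by_cases hb : b = 0
  · subst hb
    right
    left
    exact hW.trans (weierstrass_equivalent_one_zero fun ha => hdisc (by simp [ha]))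
  · obtain ⟨ν, hν, hE''⟩ := weierstrass_equivalent_one (a := a) hb
    by_cases ha : a = 0
    · right
      right
      have := hW.trans hE''
      rwa [ha, zero_mul] at this
    · left
      have hν0 : ν ≠ 0 := by
        rintro rfl
        simp at hν
      refine ⟨a * ν ^ 2, mul_ne_zero ha (pow_ne_zero 2 hν0), fun h => hdisc ?_, hW.trans hE''⟩
      linear_combination b ^ 2 * h - 4 * a ^ 3 * (b * ν ^ 3 + 1) * hν

/-- Here (αz + βy)^3 + (αz - βy)^3 = 2α^3 z^3 + 6αβ^2 y^2 z, which dictates α and β. -/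
theorem fermat_equivalent_weierstrass : Equivalent fermat (weierstrass 0 1) := by
  obtain ⟨α, hα⟩ := IsAlgClosed.exists_pow_nat_eq (1 / 2 : ℂ) (n := 3) (by norm_num)
  have hα0 : α ≠ 0 := by
    rintro rfl
    norm_num at hα
  obtain ⟨β, hβ⟩ := IsAlgClosed.exists_pow_nat_eq (-1 / (6 * α)) (n := 2) (by norm_num)
  have hβ' : 6 * α * β ^ 2 = -1 := by
    rw [hβ]
    field_simp
  have hβ0 : β ≠ 0 := by
    rintro rfl
    simp at hβ'
  refine equivalent_of_det_ne_zero !![1, 0, 0; 0, β, α; 0, -β, α] ?_ fun x y z => ?_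
  · have : β * α + α * β ≠ 0 := by
      rw [mul_comm α β, ← two_mul]
      simp [hα0, hβ0]
    simpa [Matrix.det_fin_three] using this
  · rw [mulVec_three, eval_weierstrass]
    simp [fermat]
    linear_combination 2 * z ^ 3 * hα + y ^ 2 * z * hβ'

/-! ### Symmetry groups -/

theorem mem_symmetryGroup {F : Poly} {A : GL (Fin 3) ℂ} :
    A ∈ symmetryGroup F ↔ linSubst (A : Matrix (Fin 3) (Fin 3) ℂ) F = F :=
  Iff.rfl

theorem symmetryGroup_linSubst (A : GL (Fin 3) ℂ) (F : Poly) :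
    symmetryGroup F = (symmetryGroup (linSubst (A : Matrix (Fin 3) (Fin 3) ℂ) F)).map
      (MulAut.conj A).toMonoidHom := by
  ext B
  rw [Subgroup.mem_map_equiv, mem_symmetryGroup, mem_symmetryGroup, MulAut.conj_symm_apply,
    ← linSubst_mul, ← Units.val_mul]
  have : A * (A⁻¹ * B * A) = B * A := by group
  rw [this, Units.val_mul, linSubst_mul]
  refine ⟨fun h => by rw [h], fun h => ?_⟩
  rw [← linSubst_inv_linSubst A (linSubst _ F), h, linSubst_inv_linSubst]

theorem Equivalent.card_symmetryGroup {F G : Poly} (h : Equivalent F G) :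
    Nat.card (symmetryGroup F) = Nat.card (symmetryGroup G) := by
  obtain ⟨A, rfl⟩ := h
  rw [symmetryGroup_linSubst A F]
  exact Subgroup.card_map_of_injective (MulAut.conj A).injective

theorem eval_smul_of_isHomogeneous {F : Poly} (hF : F.IsHomogeneous 3) (k : ℂ) (v : Fin 3 → ℂ) :
    eval (k • v) F = k ^ 3 * eval v F := by
  obtain ⟨c, rfl⟩ := exists_eq_cubic hF
  simp only [eval_cubic, Pi.smul_apply, smul_eq_mul]
  ring

theorem scalar_mem_symmetryGroup_iff {F : Poly} (hF : F.IsHomogeneous 3) (h0 : F ≠ 0) (u : ℂˣ) :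
    Matrix.GeneralLinearGroup.scalar (Fin 3) u ∈ symmetryGroup F ↔ u ^ 3 = 1 := by
  have key : ∀ v, eval v
      (linSubst (Matrix.GeneralLinearGroup.scalar (Fin 3) u : Matrix (Fin 3) (Fin 3) ℂ) F) =
        (u : ℂ) ^ 3 * eval v F := by
    intro v
    rw [eval_linSubst, ← eval_smul_of_isHomogeneous hF]
    congr 2
    ext i
    simp [Matrix.mulVec_diagonal]
  rw [mem_symmetryGroup]
  constructor
  · intro h
    by_contra hu
    apply h0
    refine MvPolynomial.funext fun v => ?_
    have h1 := key v
    rw [h] at h1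
    have h2 : ((u : ℂ) ^ 3 - 1) * eval v F = 0 := by linear_combination -h1
    rcases mul_eq_zero.1 h2 with h3 | h3
    · exact absurd (Units.ext (by simpa using sub_eq_zero.1 h3)) hu
    · simpa using h3
  · intro h
    refine MvPolynomial.funext fun v => ?_
    rw [key, ← Units.val_pow_eq_pow_val, h, Units.val_one, one_mul]

/-- The kernel of G_F → Γ_F consists of the scalars preserving F, that is, of the three cube roots
of unity. -/
theorem card_symmetryGroup_eq {F : Poly} (hF : F.IsHomogeneous 3) (h0 : F ≠ 0) :
    Nat.card (symmetryGroup F) = 3 * Nat.card (projectiveSymmetryGroup F) := by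
  set f := projection.comp (symmetryGroup F).subtype with hf
  have hrange : f.range = projectiveSymmetryGroup F := by
    rw [hf, MonoidHom.range_comp, Subgroup.range_subtype, projectiveSymmetryGroup]
  have hker : Nat.card f.ker = 3 := by
    refine Eq.trans (Eq.symm ?_) (Complex.card_rootsOfUnity 3)
    have hmem : ∀ u : ℂˣ, u ^ 3 = 1 →
        Matrix.GeneralLinearGroup.scalar (Fin 3) u ∈ symmetryGroup F := fun u hu =>
      (scalar_mem_symmetryGroup_iff hF h0 u).2 hu
    refine Nat.card_eq_of_bijective (fun u : rootsOfUnity 3 ℂ => ⟨⟨_, hmem u u.2⟩, ?_⟩) ⟨?_, ?_⟩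
    · rw [MonoidHom.mem_ker]
      change (QuotientGroup.mk' _) _ = 1
      rw [QuotientGroup.mk'_apply, QuotientGroup.eq_one_iff,
        Matrix.GeneralLinearGroup.center_eq_range_scalar]
      exact ⟨u, rfl⟩
    · intro u v h
      have h1 : Matrix.GeneralLinearGroup.scalar (Fin 3) (u : ℂˣ) =
          Matrix.GeneralLinearGroup.scalar (Fin 3) (v : ℂˣ) :=
        congrArg (fun x : f.ker => (x : symmetryGroup F).1) h
      have h2 := congrArg (fun M : GL (Fin 3) ℂ => (M : Matrix (Fin 3) (Fin 3) ℂ) 0 0) h1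
      exact Subtype.ext (Units.ext (by simpa using h2))
    · rintro ⟨⟨B, hB⟩, hB'⟩
      rw [MonoidHom.mem_ker] at hB'
      change (QuotientGroup.mk' _) B = 1 at hB'
      rw [QuotientGroup.mk'_apply, QuotientGroup.eq_one_iff,
        Matrix.GeneralLinearGroup.center_eq_range_scalar] at hB'
      obtain ⟨u, rfl⟩ := hB'
      exact ⟨⟨u, (scalar_mem_symmetryGroup_iff hF h0 u).1 hB⟩, rfl⟩
  rw [← f.ker.card_mul_index, Subgroup.index_ker, hker, hrange]

/-- By the chain rule, symmetries permute the critical points. For the cusp and the node this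
determines the third column of the matrix up to a scalar. -/
theorem eval_pderiv_mulVec_eq_zero {F : Poly} {A : GL (Fin 3) ℂ} (hA : A ∈ symmetryGroup F)
    {v : Fin 3 → ℂ} (hv : ∀ i, eval v (pderiv i F) = 0) (j : Fin 3) :
    eval ((A : Matrix (Fin 3) (Fin 3) ℂ).mulVec v) (pderiv j F) = 0 := by
  have h := mem_symmetryGroup.1 (inv_mem hA)
  rw [← h, pderiv_linSubst, map_sum]
  refine Finset.sum_eq_zero fun i _ => ?_
  rw [map_mul, eval_linSubst, Matrix.mulVec_mulVec, Units.inv_mul, Matrix.one_mulVec, hv, mul_zero]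

/-! ### Symmetries of the cusp -/

theorem exists_eq_of_matrix (A : Matrix (Fin 3) (Fin 3) ℂ) :
    ∃ a b c d e f g h i, A = !![a, b, c; d, e, f; g, h, i] :=
  ⟨_, _, _, _, _, _, _, _, _, Matrix.eta_fin_three A⟩

theorem eq_diagonal_of_mem_symmetryGroup_cusp {B : GL (Fin 3) ℂ} (hB : B ∈ symmetryGroup cusp) :
    ∃ p q r : ℂ, (B : Matrix (Fin 3) (Fin 3) ℂ) = Matrix.diagonal ![p, q, r] ∧
      p ^ 3 = 1 ∧ q ^ 2 * r = 1 := by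
  have hgrad := eval_pderiv_mulVec_eq_zero hB (v := ![0, 0, 1]) fun i => by
    fin_cases i <;> simp [cusp, pderiv_X]
  have h := linSubst_eq_iff.1 (mem_symmetryGroup.1 hB)
  obtain ⟨a, b, c, d, e, f, g, k, i, hM⟩ := exists_eq_of_matrix (B : Matrix (Fin 3) (Fin 3) ℂ)
  rw [hM] at hgrad h ⊢
  have g0 := hgrad 0
  have g2 := hgrad 2
  rw [mulVec_three] at g0 g2
  simp [cusp, pderiv_X] at g0 g2
  subst g0 g2
  simp only [mulVec_three, eval_cusp] at h
  obtain ⟨h0, h1, h2, h3, -, -, h6, h7, -, -⟩ := coeff_eq_zero_of_forall_eval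
    (c₀ := a ^ 3 - d ^ 2 * g - 1) (c₁ := 3 * a ^ 2 * b - 2 * d * e * g - d ^ 2 * k)
    (c₂ := -d ^ 2 * i) (c₃ := 3 * a * b ^ 2 - e ^ 2 * g - 2 * d * e * k)
    (c₄ := -2 * d * e * i) (c₅ := 0) (c₆ := b ^ 3 - e ^ 2 * k) (c₇ := 1 - e ^ 2 * i)
    (c₈ := 0) (c₉ := 0) fun x y z => by linear_combination h x y z
  have hei : e ^ 2 * i = 1 := by linear_combination -h7
  have he : e ≠ 0 := by
    rintro rfl
    simp at hei
  have hi : i ≠ 0 := by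
    rintro rfl
    simp at hei
  have hd : d = 0 := by simpa [hi] using h2
  subst hd
  have ha : a ^ 3 = 1 := by linear_combination h0
  have ha0 : a ≠ 0 := by
    rintro rfl
    simp at ha
  have hb : b = 0 := by simpa [ha0] using h1
  subst hb
  have hg : g = 0 := by simpa [he] using h3
  have hk : k = 0 := by simpa [he] using h6
  subst hg hk
  refine ⟨a, e, i, ?_, ha, hei⟩
  ext i j
  fin_cases i <;> fin_cases j <;> simp

theorem linSubst_diagonal_cusp {p q r : ℂ} (hp : p ^ 3 = 1) (hq : q ^ 2 * r = 1) :
    linSubst (Matrix.diagonal ![p, q, r]) cusp = cusp := by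
  refine linSubst_eq_iff.2 fun x y z => ?_
  have : (Matrix.diagonal ![p, q, r]).mulVec ![x, y, z] = ![p * x, q * y, r * z] := by
    ext i
    fin_cases i <;> simp [Matrix.mulVec_diagonal]
  rw [this, eval_cusp, eval_cusp]
  linear_combination x ^ 3 * hp - y ^ 2 * z * hq

theorem mem_symmetryGroup_cusp {B : GL (Fin 3) ℂ} :
    B ∈ symmetryGroup cusp ↔ ∃ ω : ℂ, ω ^ 3 = 1 ∧ ∃ D ∈ cuspGroup,
      (B : Matrix (Fin 3) (Fin 3) ℂ) = ω • (D : Matrix (Fin 3) (Fin 3) ℂ) := by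
  constructor
  · intro hB
    obtain ⟨p, q, r, hM, hp, hq⟩ := eq_diagonal_of_mem_symmetryGroup_cusp hB
    have hp0 : p ≠ 0 := by
      rintro rfl
      simp at hp
    have hq0 : q ≠ 0 := by
      rintro rfl
      simp at hq
    -- Dividing diag(p, q, r) by p leaves α = q/p, and r/p = 1/α^2 follows from p^3 = 1 and q^2 r =
    -- 1.
    refine ⟨p, hp, Matrix.GeneralLinearGroup.mkOfDetNeZero
      (Matrix.diagonal ![1, q / p, 1 / (q / p) ^ 2]) ?_, ⟨q / p, div_ne_zero hq0 hp0, rfl⟩, ?_⟩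
    · simp [Fin.prod_univ_three, hp0, hq0]
    · rw [hM]
      change _ = p • Matrix.diagonal _
      rw [← Matrix.diagonal_smul]
      congr 1
      ext i
      fin_cases i
      · simp
      · simp
        field_simp
      · simp
        field_simp
        linear_combination hq - hp
  · rintro ⟨ω, hω, D, ⟨α, hα, hD⟩, hB⟩
    have hω0 : ω ≠ 0 := by
      rintro rfl
      simp at hω
    rw [mem_symmetryGroup, hB, hD, ← Matrix.diagonal_smul]
    have : ω • ![1, α, 1 / α ^ 2] = ![ω, ω * α, ω / α ^ 2] := by
      ext i
      fin_cases i <;> simp [div_eq_mul_inv]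
    rw [this]
    refine linSubst_diagonal_cusp hω ?_
    field_simp
    exact hω

theorem mem_symmetryGroup_iff_of_cusp {F : Poly} {A : GL (Fin 3) ℂ}
    (hA : cusp = linSubst (A : Matrix (Fin 3) (Fin 3) ℂ) F) (B : GL (Fin 3) ℂ) :
    B ∈ symmetryGroup F ↔ ∃ ω : ℂ, ω ^ 3 = 1 ∧ ∃ D ∈ cuspGroup,
      (B : Matrix (Fin 3) (Fin 3) ℂ) =
        ω • ((A * D * A⁻¹ : GL (Fin 3) ℂ) : Matrix (Fin 3) (Fin 3) ℂ) := by
  rw [symmetryGroup_linSubst A F, ← hA, Subgroup.mem_map_equiv, MulAut.conj_symm_apply,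
    mem_symmetryGroup_cusp]
  refine exists_congr fun ω => and_congr_right fun _ => exists_congr fun D =>
    and_congr_right fun _ => ?_
  constructor
  · intro h
    have : B = A * (A⁻¹ * B * A) * A⁻¹ := by group
    rw [this]
    simp only [Units.val_mul] at h ⊢
    rw [h]
    simp
  · intro h
    simp only [Units.val_mul] at h ⊢
    rw [h]
    simp [Matrix.mul_assoc]

theorem projectiveSymmetryGroup_of_cusp {F : Poly} {A : GL (Fin 3) ℂ}
    (hA : cusp = linSubst (A : Matrix (Fin 3) (Fin 3) ℂ) F) :
    projectiveSymmetryGroup F =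
      (cuspGroup.map (MulAut.conj A).toMonoidHom).map projection := by
  ext P
  constructor
  · rintro ⟨B, hB, rfl⟩
    obtain ⟨ω, hω, D, hD, h⟩ := (mem_symmetryGroup_iff_of_cusp hA B).1 hB
    have hω0 : ω ≠ 0 := by
      rintro rfl
      simp at hω
    refine ⟨A * D * A⁻¹, ⟨D, hD, rfl⟩, ?_⟩
    refine QuotientGroup.eq.2 ?_
    rw [Matrix.GeneralLinearGroup.center_eq_range_scalar]
    refine ⟨Units.mk0 ω hω0, ?_⟩
    have : B = (A * D * A⁻¹) * Matrix.GeneralLinearGroup.scalar (Fin 3) (Units.mk0 ω hω0) := by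
      refine Units.ext ?_
      rw [h, Units.val_mul]
      ext i j
      simp [mul_comm]
    rw [this]
    group
  · rintro ⟨_, ⟨D, hD, rfl⟩, rfl⟩
    exact ⟨_, (mem_symmetryGroup_iff_of_cusp hA _).2 ⟨1, one_pow _, D, hD, by simp⟩, rfl⟩

open scoped Matrix.Norms.Operator in
theorem hasDerivAt_exp_smul_apply (Y : Matrix (Fin 3) (Fin 3) ℂ) (i j : Fin 3) :
    HasDerivAt (fun t : ℂ => NormedSpace.exp (t • Y) i j) (Y i j) 0 := by
  have h := hasDerivAt_exp_smul_const (𝕂 := ℂ) Y 0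
  rw [zero_smul, NormedSpace.exp_zero, one_mul] at h
  exact ((Matrix.entryLinearMap ℂ ℂ i j).toContinuousLinearMap.hasFDerivAt).comp_hasDerivAt
    (0 : ℂ) h

theorem exp_smul_diagonal (t : ℂ) :
    NormedSpace.exp (t • Matrix.diagonal ![(0 : ℂ), 1, -2]) =
      Matrix.diagonal ![1, Complex.exp t, Complex.exp (-2 * t)] := by
  rw [← Matrix.diagonal_smul, Matrix.exp_diagonal]
  congr 1
  ext i
  rw [Pi.coe_exp]
  fin_cases i <;> simp [Complex.exp_eq_exp_ℂ, mul_comm]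

theorem isUnit_exp_matrix (Y : Matrix (Fin 3) (Fin 3) ℂ) :
    ∃ B : GL (Fin 3) ℂ, (B : Matrix (Fin 3) (Fin 3) ℂ) = NormedSpace.exp Y :=
  Matrix.isUnit_exp Y

/-- The entries of exp(tY) satisfy the equations of the diagonal symmetries for all t. Their
derivatives at t = 0 say that Y is diagonal with Y 0 0 = 0 and 2 Y 1 1 + Y 2 2 = 0. -/
theorem forall_linSubst_exp_cusp_iff {Y : Matrix (Fin 3) (Fin 3) ℂ} :
    (∀ t : ℂ, linSubst (NormedSpace.exp (t • Y)) cusp = cusp) ↔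
      ∃ c : ℂ, Y = c • Matrix.diagonal ![(0 : ℂ), 1, -2] := by
  constructor
  · intro h
    have key : ∀ t : ℂ, (∀ i j, i ≠ j → NormedSpace.exp (t • Y) i j = 0) ∧
        NormedSpace.exp (t • Y) 0 0 ^ 3 = 1 ∧
        NormedSpace.exp (t • Y) 1 1 ^ 2 * NormedSpace.exp (t • Y) 2 2 = 1 := by
      intro t
      obtain ⟨B, hB⟩ := isUnit_exp_matrix (t • Y)
      rw [← hB]
      obtain ⟨p, q, r, hM, hp, hq⟩ := eq_diagonal_of_mem_symmetryGroup_cusp (B := B)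
        (mem_symmetryGroup.2 (by rw [hB]; exact h t))
      rw [hM]
      refine ⟨fun i j hij => Matrix.diagonal_apply_ne _ hij, ?_, ?_⟩
      · simpa using hp
      · simpa using hq
    have hone : ∀ i : Fin 3, NormedSpace.exp ((0 : ℂ) • Y) i i = 1 := by
      intro i
      simp
    have hoff : ∀ i j, i ≠ j → Y i j = 0 := fun i j hij => by
      have h1 := hasDerivAt_exp_smul_apply Y i j
      simp only [(key _).1 i j hij] at h1
      exact h1.unique (hasDerivAt_const _ _)
    have h00 : Y 0 0 = 0 := by
      have h1 := (hasDerivAt_exp_smul_apply Y 0 0).pow 3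
      have h2 : HasDerivAt (fun t : ℂ => NormedSpace.exp (t • Y) 0 0 ^ 3) 0 0 := by
        simp only [(key _).2.1]
        exact hasDerivAt_const _ _
      have h3 := h1.unique h2
      rw [hone] at h3
      simpa using h3
    have h22 : Y 2 2 = -2 * Y 1 1 := by
      have h1 := ((hasDerivAt_exp_smul_apply Y 1 1).pow 2).mul (hasDerivAt_exp_smul_apply Y 2 2)
      have h2 : HasDerivAt
          (fun t : ℂ => NormedSpace.exp (t • Y) 1 1 ^ 2 * NormedSpace.exp (t • Y) 2 2) 0 0 := by
        simp only [(key _).2.2]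
        exact hasDerivAt_const _ _
      have h3 := h1.unique h2
      simp only [Pi.pow_apply, hone] at h3
      norm_num at h3
      linear_combination h3
    refine ⟨Y 1 1, ?_⟩
    ext i j
    by_cases hij : i = j
    · subst hij
      fin_cases i
      · simpa using h00
      · simp
      · simp [h22, mul_comm]
    · simp [hoff i j hij, Matrix.diagonal_apply_ne _ hij]
  · rintro ⟨c, rfl⟩ t
    rw [smul_smul, exp_smul_diagonal]
    refine linSubst_diagonal_cusp (one_pow _) ?_
    rw [← Complex.exp_nat_mul, ← Complex.exp_add]
    simp

/-- Since exp commutes with conjugation, the set in `symmetryDim` is the conjugate by A of the line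
found for the cusp; it is already a subspace. -/
theorem symmetryDim_of_cusp {F : Poly} {A : GL (Fin 3) ℂ}
    (hA : cusp = linSubst (A : Matrix (Fin 3) (Fin 3) ℂ) F) : symmetryDim F = 1 := by
  set Z : Matrix (Fin 3) (Fin 3) ℂ := (A : Matrix (Fin 3) (Fin 3) ℂ) *
    Matrix.diagonal ![(0 : ℂ), 1, -2] * ((A⁻¹ : GL (Fin 3) ℂ) : Matrix (Fin 3) (Fin 3) ℂ) with hZ
  have hset : {X : Matrix (Fin 3) (Fin 3) ℂ | ∀ t : ℂ, linSubst (NormedSpace.exp (t • X)) F = F} =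
      (Submodule.span ℂ {Z} : Set (Matrix (Fin 3) (Fin 3) ℂ)) := by
    ext X
    rw [Set.mem_ofPred_eq, SetLike.mem_coe, Submodule.mem_span_singleton]
    have h1 : (∀ t : ℂ, linSubst (NormedSpace.exp (t • X)) F = F) ↔
        ∀ t : ℂ, linSubst (NormedSpace.exp (t •
          (((A⁻¹ : GL (Fin 3) ℂ) : Matrix (Fin 3) (Fin 3) ℂ) * X * A))) cusp = cusp := by
      refine forall_congr' fun t => ?_
      obtain ⟨B, hB⟩ := isUnit_exp_matrix (t • X)
      have : NormedSpace.exp (t • (((A⁻¹ : GL (Fin 3) ℂ) : Matrix (Fin 3) (Fin 3) ℂ) * X * A)) =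
          ((A⁻¹ * B * A : GL (Fin 3) ℂ) : Matrix (Fin 3) (Fin 3) ℂ) := by
        rw [Units.val_mul, Units.val_mul, hB, ← Matrix.exp_units_conj']
        simp
      rw [this, ← hB, ← mem_symmetryGroup, ← mem_symmetryGroup, symmetryGroup_linSubst A F, ← hA,
        Subgroup.mem_map_equiv, MulAut.conj_symm_apply]
    rw [h1, forall_linSubst_exp_cusp_iff]
    refine exists_congr fun c => ?_
    constructor
    · intro h
      have : X = (A : Matrix (Fin 3) (Fin 3) ℂ) *
          (((A⁻¹ : GL (Fin 3) ℂ) : Matrix (Fin 3) (Fin 3) ℂ) * X * A) *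
            ((A⁻¹ : GL (Fin 3) ℂ) : Matrix (Fin 3) (Fin 3) ℂ) := by
        simp [Matrix.mul_assoc]
      rw [this, h, hZ]
      simp
    · rintro rfl
      rw [hZ]
      simp [Matrix.mul_assoc]
  rw [symmetryDim, hset, Submodule.span_eq]
  refine finrank_span_singleton fun h => ?_
  have h2 : Matrix.diagonal ![(0 : ℂ), 1, -2] =
      ((A⁻¹ : GL (Fin 3) ℂ) : Matrix (Fin 3) (Fin 3) ℂ) * Z * A := by
    rw [hZ]
    simp [Matrix.mul_assoc]
  rw [h] at h2
  simpa using congrFun (congrFun h2 1) 1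

/-! ### Symmetries of the node -/

/-- B fixes the node, so the terms containing z transform to r (ax + by)(dx + ey) z, which must
equal xyz. Thus B preserves or exchanges the two tangents, and the remaining coefficients kill g and
k. -/
theorem eq_of_mem_symmetryGroup_nodeAxes {B : GL (Fin 3) ℂ} (hB : B ∈ symmetryGroup nodeAxes) :
    ∃ p q r : ℂ, p ^ 3 = 1 ∧ q ^ 3 = 1 ∧ p * q * r = 1 ∧
      ((B : Matrix (Fin 3) (Fin 3) ℂ) = !![p, 0, 0; 0, q, 0; 0, 0, r] ∨
        (B : Matrix (Fin 3) (Fin 3) ℂ) = !![0, p, 0; q, 0, 0; 0, 0, r]) := by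
  have hgrad := eval_pderiv_mulVec_eq_zero hB (v := ![0, 0, 1]) fun i => by
    fin_cases i <;> simp [nodeAxes, pderiv_X]
  have h := linSubst_eq_iff.1 (mem_symmetryGroup.1 hB)
  obtain ⟨a, b, c, d, e, f, g, k, r, hM⟩ := exists_eq_of_matrix (B : Matrix (Fin 3) (Fin 3) ℂ)
  rw [hM] at hgrad h ⊢
  have g0 := hgrad 0
  have g1 := hgrad 1
  have g2 := hgrad 2
  rw [mulVec_three] at g0 g1 g2
  simp [nodeAxes, pderiv_X] at g0 g1 g2
  obtain ⟨rfl, rfl⟩ : c = 0 ∧ f = 0 := by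
    rcases g2 with rfl | rfl
    · simpa using g1
    · simpa using g0
  simp only [mulVec_three, eval_nodeAxes] at h
  obtain ⟨h0, h1, h2, h3, h4, -, h6, h7, -, -⟩ := coeff_eq_zero_of_forall_eval
    (c₀ := a ^ 3 + d ^ 3 + a * d * g - 1)
    (c₁ := 3 * a ^ 2 * b + 3 * d ^ 2 * e + (a * e + b * d) * g + a * d * k)
    (c₂ := a * d * r) (c₃ := 3 * a * b ^ 2 + 3 * d * e ^ 2 + (a * e + b * d) * k + b * e * g)
    (c₄ := (a * e + b * d) * r - 1) (c₅ := 0) (c₆ := b ^ 3 + e ^ 3 + b * e * k - 1)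
    (c₇ := b * e * r) (c₈ := 0) (c₉ := 0) fun x y z => by linear_combination h x y z
  have h4 : (a * e + b * d) * r = 1 := by linear_combination h4
  have hr : r ≠ 0 := right_ne_zero_of_mul_eq_one h4
  have had : a * d = 0 := by simpa [hr] using h2
  have hbe : b * e = 0 := by simpa [hr] using h7
  by_cases hd : d = 0
  · subst hd
    have he : e ≠ 0 := by
      rintro rfl
      simp at h4
    have ha : a ≠ 0 := by
      rintro rfl
      simp at h4
    have hb : b = 0 := by simpa [he] using hbe
    subst hb
    have hg : g = 0 := by simpa [ha, he] using h1
    have hk : k = 0 := by simpa [ha, he] using h3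
    subst hg hk
    exact ⟨a, e, r, by linear_combination h0, by linear_combination h6,
      by linear_combination h4, Or.inl rfl⟩
  · have ha : a = 0 := by simpa [hd] using had
    subst ha
    have hb : b ≠ 0 := by
      rintro rfl
      simp at h4
    have he : e = 0 := by simpa [hb] using hbe
    subst he
    have hg : g = 0 := by simpa [hb, hd] using h1
    have hk : k = 0 := by simpa [hb, hd] using h3
    subst hg hk
    exact ⟨b, d, r, by linear_combination h6, by linear_combination h0,
      by linear_combination h4, Or.inr rfl⟩

/-- The symmetries of the nodal cubic, as matrices. -/
def nodeMatrix (t : Bool × rootsOfUnity 3 ℂ × rootsOfUnity 3 ℂ) : Matrix (Fin 3) (Fin 3) ℂ :=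
  let p : ℂ := (t.2.1 : ℂˣ)
  let q : ℂ := (t.2.2 : ℂˣ)
  if t.1 then !![p, 0, 0; 0, q, 0; 0, 0, 1 / (p * q)]
  else !![0, p, 0; q, 0, 0; 0, 0, 1 / (p * q)]

theorem rootsOfUnity_pow_eq_one {n : ℕ} (u : rootsOfUnity n ℂ) : ((u : ℂˣ) : ℂ) ^ n = 1 := by
  rw [← Units.val_pow_eq_pow_val, (mem_rootsOfUnity n _).1 u.2, Units.val_one]

theorem det_nodeMatrix_ne_zero (t : Bool × rootsOfUnity 3 ℂ × rootsOfUnity 3 ℂ) :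
    (nodeMatrix t).det ≠ 0 := by
  obtain ⟨b, u, v⟩ := t
  cases b <;> simp [nodeMatrix, Matrix.det_fin_three]

theorem nodeMatrix_mem (t : Bool × rootsOfUnity 3 ℂ × rootsOfUnity 3 ℂ) :
    Matrix.GeneralLinearGroup.mkOfDetNeZero _ (det_nodeMatrix_ne_zero t) ∈
      symmetryGroup nodeAxes := by
  rw [mem_symmetryGroup]
  change linSubst (nodeMatrix t) nodeAxes = nodeAxes
  obtain ⟨b, u, v⟩ := t
  have hu := rootsOfUnity_pow_eq_one u
  have hv := rootsOfUnity_pow_eq_one v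
  have hu0 := Units.ne_zero (u : ℂˣ)
  have hv0 := Units.ne_zero (v : ℂˣ)
  refine linSubst_eq_iff.2 fun x y z => ?_
  cases b
  · simp only [nodeMatrix, Bool.false_eq_true, if_false, mulVec_three, eval_nodeAxes]
    field_simp
    linear_combination (u : ℂˣ) * (v : ℂˣ) * (y ^ 3 * hu + x ^ 3 * hv)
  · simp only [nodeMatrix, if_true, mulVec_three, eval_nodeAxes]
    field_simp
    linear_combination (u : ℂˣ) * (v : ℂˣ) * (x ^ 3 * hu + y ^ 3 * hv)

theorem card_symmetryGroup_nodeAxes : Nat.card (symmetryGroup nodeAxes) = 18 := by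
  have : Nat.card (Bool × rootsOfUnity 3 ℂ × rootsOfUnity 3 ℂ) = 18 := by
    rw [Nat.card_prod, Nat.card_prod, Complex.card_rootsOfUnity, Nat.card_eq_fintype_card,
      Fintype.card_bool]
  rw [← this]
  symm
  refine Nat.card_eq_of_bijective (fun t => ⟨_, nodeMatrix_mem t⟩) ⟨?_, ?_⟩
  · intro s t h
    have hM : nodeMatrix s = nodeMatrix t :=
      congrArg (fun B : symmetryGroup nodeAxes => (B.1 : Matrix (Fin 3) (Fin 3) ℂ)) h
    obtain ⟨b, u, v⟩ := s
    obtain ⟨b', u', v'⟩ := t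
    have h00 := congrFun (congrFun hM 0) 0
    have h01 := congrFun (congrFun hM 0) 1
    have h10 := congrFun (congrFun hM 1) 0
    have h11 := congrFun (congrFun hM 1) 1
    cases b <;> cases b' <;> simp [nodeMatrix] at h00 h01 h10 h11
    · rw [Subtype.ext (Units.ext h01), Subtype.ext (Units.ext h10)]
    · rw [Subtype.ext (Units.ext h00), Subtype.ext (Units.ext h11)]
  · rintro ⟨B, hB⟩
    obtain ⟨p, q, r, hp, hq, hr, h⟩ := eq_of_mem_symmetryGroup_nodeAxes hB
    have hp0 : p ≠ 0 := by
      rintro rfl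
      simp at hp
    have hq0 : q ≠ 0 := by
      rintro rfl
      simp at hq
    have hr' : 1 / (p * q) = r := by
      field_simp
      linear_combination -hr
    have hu : Units.mk0 p hp0 ∈ rootsOfUnity 3 ℂ := by
      rw [mem_rootsOfUnity]
      exact Units.ext (by simpa using hp)
    have hv : Units.mk0 q hq0 ∈ rootsOfUnity 3 ℂ := by
      rw [mem_rootsOfUnity]
      exact Units.ext (by simpa using hq)
    rcases h with h | h
    · refine ⟨(true, ⟨_, hu⟩, ⟨_, hv⟩), Subtype.ext (Units.ext ?_)⟩
      change nodeMatrix (true, ⟨_, hu⟩, ⟨_, hv⟩) = (B : Matrix (Fin 3) (Fin 3) ℂ)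
      rw [h]
      simp only [nodeMatrix, if_true, Units.val_mk0, hr']
    · refine ⟨(false, ⟨_, hu⟩, ⟨_, hv⟩), Subtype.ext (Units.ext ?_)⟩
      change nodeMatrix (false, ⟨_, hu⟩, ⟨_, hv⟩) = (B : Matrix (Fin 3) (Fin 3) ℂ)
      rw [h]
      simp only [nodeMatrix, Bool.false_eq_true, if_false, Units.val_mk0, hr']

/-! ### Orders of the two symmetry groups of the node -/

theorem isHomogeneous_cubic (c : Fin 10 → ℂ) : (cubic c).IsHomogeneous 3 := by
  have key : ∀ (k : ℂ) (i j l : ℕ), i + j + l = 3 →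
      (C k * X 0 ^ i * X 1 ^ j * X 2 ^ l : Poly).IsHomogeneous 3 := by
    intro k i j l h
    have := ((((isHomogeneous_C (Fin 3) k).mul (isHomogeneous_X_pow (R := ℂ) (0 : Fin 3) i)).mul
      (isHomogeneous_X_pow (R := ℂ) (1 : Fin 3) j)).mul
      (isHomogeneous_X_pow (R := ℂ) (2 : Fin 3) l))
    rwa [zero_add, h] at this
  refine (((((((((?_ : IsHomogeneous _ 3).add ?_).add ?_).add ?_).add ?_).add ?_).add ?_).add
    ?_).add ?_).add ?_
  · simpa using key (c 0) 3 0 0 rfl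
  · simpa using key (c 1) 2 1 0 rfl
  · simpa using key (c 2) 2 0 1 rfl
  · simpa using key (c 3) 1 2 0 rfl
  · simpa using key (c 4) 1 1 1 rfl
  · simpa using key (c 5) 1 0 2 rfl
  · simpa using key (c 6) 0 3 0 rfl
  · simpa using key (c 7) 0 2 1 rfl
  · simpa using key (c 8) 0 1 2 rfl
  · simpa using key (c 9) 0 0 3 rfl

theorem nodeAxes_eq_cubic : nodeAxes = cubic ![1, 0, 0, 0, 1, 0, 1, 0, 0, 0] := by
  refine poly_ext fun x y z => ?_
  rw [eval_nodeAxes, eval_cubic_mk]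
  ring

theorem weierstrass_eq_cubic (a b : ℂ) :
    weierstrass a b = cubic ![1, 0, 0, 0, 0, a, 0, -1, 0, b] := by
  refine poly_ext fun x y z => ?_
  rw [eval_weierstrass, eval_cubic_mk]
  ring

theorem Equivalent.card_symmetryGroup_eq_three_mul {F : Poly} {c : Fin 10 → ℂ}
    (h : Equivalent F (cubic c)) (hc : c 0 = 1) :
    Nat.card (symmetryGroup (cubic c)) = 3 * Nat.card (projectiveSymmetryGroup F) := by
  rw [← h.card_symmetryGroup]
  refine card_symmetryGroup_eq (h.symm.isHomogeneous (isHomogeneous_cubic c)) ?_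
  rintro rfl
  obtain ⟨A, hA⟩ := h
  have := congrArg (eval ![1, 0, 0]) hA
  simp [eval_cubic_vec, hc, linSubst] at this

theorem card_of_equivalent_node {F : Poly} (h : Equivalent F node) :
    Nat.card (projectiveSymmetryGroup F) = 6 ∧ Nat.card (symmetryGroup F) = 18 := by
  have h' := h.trans nodeAxes_equivalent_node.symm
  have h1 := card_symmetryGroup_nodeAxes
  have h2 := h'.card_symmetryGroup
  rw [nodeAxes_eq_cubic] at h'
  have h3 := h'.card_symmetryGroup_eq_three_mul rfl
  rw [← nodeAxes_eq_cubic] at h3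
  omega

/-! ### Flexes of a cubic in Weierstrass form -/

/-- The affine points of the curve `y ^ 2 = x ^ 3 + a x + b` whose abscissa is a root of the third
division polynomial. -/
def affineFlexes (a b : ℂ) : Set (ℂ × ℂ) :=
  {P | P.2 ^ 2 = P.1 ^ 3 + a * P.1 + b ∧
    3 * P.1 ^ 4 + 6 * a * P.1 ^ 2 + 12 * b * P.1 - a ^ 2 = 0}

theorem discriminant_eq_zero {a b x : ℂ} (h₁ : x ^ 3 + a * x + b = 0) (h₂ : 3 * x ^ 2 + a = 0) :
    4 * a ^ 3 + 27 * b ^ 2 = 0 := by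
  obtain rfl : a = -3 * x ^ 2 := by linear_combination h₂
  obtain rfl : b = 2 * x ^ 3 := by linear_combination h₁
  ring

/-- By the identity (3x^2 + a)^2 = 12x (x^3 + ax + b) - (3x^4 + 6ax^2 + 12bx - a^2), a common root
would be a double root of x^3 + ax + b. -/
theorem ne_zero_of_divisionPolynomial {a b x : ℂ} (hd : 4 * a ^ 3 + 27 * b ^ 2 ≠ 0)
    (hx : 3 * x ^ 4 + 6 * a * x ^ 2 + 12 * b * x - a ^ 2 = 0) : x ^ 3 + a * x + b ≠ 0 := by
  intro h
  refine hd (discriminant_eq_zero h ?_)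
  have : (3 * x ^ 2 + a) ^ 2 = 0 := by linear_combination 12 * x * h - hx
  simpa using this

/-- The derivative of the quartic is 12(x^3 + ax + b), which has no root in common with it, so the
quartic is separable. -/
theorem card_roots_divisionPolynomial {a b : ℂ} (hd : 4 * a ^ 3 + 27 * b ^ 2 ≠ 0) :
    Nat.card {x : ℂ // 3 * x ^ 4 + 6 * a * x ^ 2 + 12 * b * x - a ^ 2 = 0} = 4 := by
  obtain ⟨p, hp⟩ : ∃ p : Polynomial ℂ, p = Polynomial.C 3 * Polynomial.X ^ 4 +
      Polynomial.C (6 * a) * Polynomial.X ^ 2 + Polynomial.C (12 * b) * Polynomial.X -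
        Polynomial.C (a ^ 2) := ⟨_, rfl⟩
  have hdeg : p.natDegree = 4 := by
    rw [hp]
    compute_degree!
  have hp0 : p ≠ 0 := by
    rintro rfl
    simp at hdeg
  have hev : ∀ x, Polynomial.aeval x p =
      3 * x ^ 4 + 6 * a * x ^ 2 + 12 * b * x - a ^ 2 := by
    intro x
    rw [hp]
    simp
  have hev' : ∀ x, Polynomial.aeval x (Polynomial.derivative p) =
      12 * (x ^ 3 + a * x + b) := by
    intro x
    rw [hp]
    simp only [Polynomial.derivative_sub, Polynomial.derivative_add, Polynomial.derivative_C_mul,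
      Polynomial.derivative_X_pow, Polynomial.derivative_X, Polynomial.derivative_C]
    simp
    ring
  have hsep : p.Separable := by
    rw [Polynomial.Separable, Polynomial.isCoprime_iff_aeval_ne_zero_of_isAlgClosed ℂ ℂ]
    intro x
    by_cases hx : Polynomial.aeval x p = 0
    · right
      rw [hev] at hx
      rw [hev']
      exact mul_ne_zero (by norm_num) (ne_zero_of_divisionPolynomial hd hx)
    · exact Or.inl hx
  have := Polynomial.card_rootSet_eq_natDegree (K := ℂ) hsep
    (IsAlgClosed.splits (p.map (algebraMap ℂ ℂ)))
  rw [hdeg, ← Nat.card_eq_fintype_card] at this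
  refine Eq.trans ?_ this
  refine Nat.card_congr (Equiv.subtypeEquivRight fun x => ?_)
  rw [Polynomial.mem_rootSet, hev]
  simp [hp0]

/-- Over each of the four abscissas there are two opposite ordinates, distinct because the ordinate
is nonzero. -/
theorem card_affineFlexes {a b : ℂ} (hd : 4 * a ^ 3 + 27 * b ^ 2 ≠ 0) :
    Nat.card (affineFlexes a b) = 8 := by
  choose f hf using fun x : ℂ =>
    IsAlgClosed.exists_pow_nat_eq (x ^ 3 + a * x + b) (n := 2) (by norm_num)
  have hcard : Nat.card
      (Bool × {x : ℂ // 3 * x ^ 4 + 6 * a * x ^ 2 + 12 * b * x - a ^ 2 = 0}) = 8 := by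
    rw [Nat.card_prod, card_roots_divisionPolynomial hd, Nat.card_eq_fintype_card,
      Fintype.card_bool]
  rw [← hcard]
  symm
  refine Nat.card_eq_of_bijective
    (fun t => ⟨(t.2, if t.1 then f t.2 else -f t.2), ?_, t.2.2⟩) ⟨?_, ?_⟩
  · rw [← hf]
    split_ifs <;> ring
  · rintro ⟨s, x, hx⟩ ⟨t, y, hy⟩ h
    have hfx : f x ≠ 0 := by
      intro h0
      refine ne_zero_of_divisionPolynomial hd hx ?_
      rw [← hf, h0]
      norm_num
    have h' := congrArg Subtype.val h
    simp only [Prod.mk.injEq] at h'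
    obtain ⟨rfl, h2⟩ := h'
    have h3 : f x ≠ -f x := fun h => hfx (self_eq_neg.1 h)
    cases s <;> cases t <;> simp at h2 ⊢
    · exact h3 h2.symm
    · exact h3 h2
  · rintro ⟨⟨x, y⟩, h1, h2⟩
    simp only at h1 h2
    rw [← hf, sq_eq_sq_iff_eq_or_eq_neg] at h1
    rcases h1 with rfl | rfl
    · exact ⟨(true, ⟨x, h2⟩), by simp⟩
    · exact ⟨(false, ⟨x, h2⟩), by simp⟩

/-- Representatives of the flexes of a cubic in Weierstrass form; `none` is the flex at
infinity. -/
def flexPoint {a b : ℂ} : Option (affineFlexes a b) → Fin 3 → ℂ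
  | none => ![0, 1, 0]
  | some P => ![P.1.1, P.1.2, 1]

theorem card_option_affineFlexes {a b : ℂ} (hd : 4 * a ^ 3 + 27 * b ^ 2 ≠ 0) :
    Nat.card (Option (affineFlexes a b)) = 9 := by
  have : Finite (affineFlexes a b) := Nat.finite_of_card_ne_zero (by
    rw [card_affineFlexes hd]
    norm_num)
  rw [Finite.card_option, card_affineFlexes hd]

theorem flexPoint_injective {a b : ℂ} {P Q : Option (affineFlexes a b)} {c : ℂ} (hc : c ≠ 0)
    (h : flexPoint P = c • flexPoint Q) : P = Q := by
  have h0 := congrFun h 0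
  have h1 := congrFun h 1
  have h2 := congrFun h 2
  rcases P with _ | ⟨⟨x, y⟩, hP⟩ <;> rcases Q with _ | ⟨⟨x', y'⟩, hQ⟩
  · rfl
  · exact absurd (by simpa [flexPoint] using h2.symm) hc
  · simp [flexPoint] at h2
  · obtain rfl : c = 1 := by simpa [flexPoint] using h2.symm
    have hx : x = x' := by simpa [flexPoint] using h0
    have hy : y = y' := by simpa [flexPoint] using h1
    subst hx hy
    rfl

theorem IsFlexLine.exists_eq_flexPoint {a b : ℂ} {v w : Fin 3 → ℂ}
    (h : IsFlexLine (weierstrass a b) v w) :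
    ∃ (P : Option (affineFlexes a b)) (c : ℂ), c ≠ 0 ∧ v = c • flexPoint P := by
  obtain ⟨hv, hw, h⟩ := h
  obtain ⟨x, y, z, rfl⟩ : ∃ x y z, v = ![x, y, z] :=
    ⟨v 0, v 1, v 2, by ext i; fin_cases i <;> rfl⟩
  obtain ⟨p, q, r, rfl⟩ : ∃ p q r, w = ![p, q, r] :=
    ⟨w 0, w 1, w 2, by ext i; fin_cases i <;> rfl⟩
  have hc : ∀ s t : ℂ, s • ![x, y, z] + t • ![p, q, r] =
      ![s * x + t * p, s * y + t * q, s * z + t * r] := by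
    intro s t
    ext i
    fin_cases i <;> simp
  simp only [hc, eval_weierstrass] at h
  have e0 := h 1 0
  have e1 := h 1 1
  have e2 := h 1 (-1)
  by_cases hz : z = 0
  · subst hz
    have hx : x = 0 := by simpa using e0
    subst hx
    refine ⟨none, y, ?_, ?_⟩
    · rintro rfl
      exact hv (by ext i; fin_cases i <;> rfl)
    · ext i
      fin_cases i <;> simp [flexPoint]
  · obtain ⟨x, rfl⟩ : ∃ x', x = x' * z := ⟨x / z, by field_simp⟩
    obtain ⟨y, rfl⟩ : ∃ y', y = y' * z := ⟨y / z, by field_simp⟩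
    -- Subtracting a multiple of v makes the direction of the flex line (p, q, 0). Then `f0`, `f1`,
    -- `f2` are the coefficients of s^3, s^2 t, s t^2: incidence, tangency and inflection.
    obtain ⟨p, rfl⟩ : ∃ p', p = p' + x * r := ⟨p - x * r, by ring⟩
    obtain ⟨q, rfl⟩ : ∃ q', q = q' + y * r := ⟨q - y * r, by ring⟩
    have f0 : y ^ 2 = x ^ 3 + a * x + b := by
      refine mul_left_cancel₀ (pow_ne_zero 3 hz) ?_
      linear_combination -e0
    have f1 : 2 * y * q = (3 * x ^ 2 + a) * p := by
      refine mul_left_cancel₀ (pow_ne_zero 2 hz) ?_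
      linear_combination -(e1 - e2) / 2 - 3 * z ^ 2 * r * f0
    have f2 : q ^ 2 = 3 * x * p ^ 2 := by
      refine mul_left_cancel₀ hz ?_
      linear_combination -(e1 + e2) / 2 + e0 - 3 * z * r ^ 2 * f0 - 2 * z * r * f1
    have hp : p ≠ 0 := by
      rintro rfl
      have hq : q = 0 := by simpa using f2
      subst hq
      refine hw (r / z) ?_
      ext i
      fin_cases i
      · simp
        field_simp
      · simp
        field_simp
      · simp
        field_simp
    have hmem : (x, y) ∈ affineFlexes a b := by
      refine ⟨f0, ?_⟩
      refine mul_left_cancel₀ (pow_ne_zero 2 hp) ?_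
      -- Squaring `f1` and inserting `f2` gives (3x^2 + a)^2 = 12 x y^2, which is the division
      -- polynomial equation on the curve.
      linear_combination (-12 * x * p ^ 2) * f0 - 4 * y ^ 2 * f2 +
        (2 * y * q + (3 * x ^ 2 + a) * p) * f1
    refine ⟨some ⟨_, hmem⟩, z, hz, ?_⟩
    ext i
    fin_cases i <;> simp [flexPoint, mul_comm]

theorem isFlexLine_weierstrass (a b : ℂ) :
    IsFlexLine (weierstrass a b) ![0, 1, 0] ![1, 0, 0] := by
  refine ⟨fun h => by simpa using congrFun h 1, fun k h => by simpa using congrFun h 0,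
    fun s t => ?_⟩
  have : s • ![(0 : ℂ), 1, 0] + t • ![1, 0, 0] = ![t, s, 0] := by
    ext i
    fin_cases i <;> simp
  rw [this, eval_weierstrass, eval_weierstrass]
  ring

theorem IsFlexLine.mulVec {F : Poly} {v w : Fin 3 → ℂ} (h : IsFlexLine F v w) {B : GL (Fin 3) ℂ}
    (hB : B ∈ symmetryGroup F) :
    IsFlexLine F ((B : Matrix (Fin 3) (Fin 3) ℂ).mulVec v)
      ((B : Matrix (Fin 3) (Fin 3) ℂ).mulVec w) := by
  have hinj : ∀ u u' : Fin 3 → ℂ, (B : Matrix (Fin 3) (Fin 3) ℂ).mulVec u =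
      (B : Matrix (Fin 3) (Fin 3) ℂ).mulVec u' → u = u' := fun u u' huu => by
    have := congrArg ((B⁻¹ : GL (Fin 3) ℂ) : Matrix (Fin 3) (Fin 3) ℂ).mulVec huu
    rwa [Matrix.mulVec_mulVec, Matrix.mulVec_mulVec, Units.inv_mul, Matrix.one_mulVec,
      Matrix.one_mulVec] at this
  have hev : ∀ u, eval ((B : Matrix (Fin 3) (Fin 3) ℂ).mulVec u) F = eval u F := fun u => by
    rw [← eval_linSubst, mem_symmetryGroup.1 hB]
  obtain ⟨h1, h2, h3⟩ := h
  refine ⟨fun h0 => h1 (hinj _ _ (by rw [h0, Matrix.mulVec_zero])),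
    fun k hk => h2 k (hinj _ _ (by rw [hk, Matrix.mulVec_smul])), fun s t => ?_⟩
  rw [← Matrix.mulVec_smul, ← Matrix.mulVec_smul, ← Matrix.mulVec_add, hev, hev, h3]

/-- The harmonic reflection whose centre is the flex `(m ^ 2 / 3, y)`, with tangent of slope `m`,
of a cubic in Weierstrass form. -/
def flexReflection (m y : ℂ) : Matrix (Fin 3) (Fin 3) ℂ :=
  !![1 - m ^ 3 / (6 * y), -m ^ 2 / (6 * y), -m ^ 2 / (6 * y) * (3 * y - m ^ 3 / 3);
    -m / 2, 1 / 2, -(3 * y - m ^ 3 / 3) / 2;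
    -m / (2 * y), -1 / (2 * y), 1 - (3 * y - m ^ 3 / 3) / (2 * y)]

/-- The matrix is 1 - Pℓ/(2y) with P = (m^2/3, y, 1) and ℓ = (m, 1, 3y - m^3/3). Since ℓ(P) = 4y, it
is -1 on P and the identity on the plane ℓ = 0. The values of a and b express that the tangent at P
has slope m and that P lies on the curve. -/
theorem linSubst_flexReflection {m y a b : ℂ} (hy : y ≠ 0) (ha : a = 2 * y * m - m ^ 4 / 3)
    (hb : b = y ^ 2 - (m ^ 2 / 3) ^ 3 - a * (m ^ 2 / 3)) :
    linSubst (flexReflection m y) (weierstrass a b) = weierstrass a b := by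
  subst hb ha
  refine linSubst_eq_iff.2 fun u v w => ?_
  rw [flexReflection, mulVec_three, eval_weierstrass, eval_weierstrass]
  field_simp
  ring

theorem det_flexReflection {m y : ℂ} (hy : y ≠ 0) : (flexReflection m y).det = -1 := by
  rw [flexReflection, Matrix.det_fin_three]
  simp
  field_simp
  ring

/-- The flexes (x, y), (x, -y) and infinity are collinear, so the reflection centred at (x, -y)
exchanges the other two. -/
theorem exists_mem_symmetryGroup_mulVec_eq_flexPoint {a b : ℂ}
    (hd : 4 * a ^ 3 + 27 * b ^ 2 ≠ 0) (P : Option (affineFlexes a b)) :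
    ∃ B ∈ symmetryGroup (weierstrass a b), ∃ c : ℂ, c ≠ 0 ∧
      (B : Matrix (Fin 3) (Fin 3) ℂ).mulVec ![0, 1, 0] = c • flexPoint P := by
  rcases P with _ | ⟨⟨x, y⟩, h1, h2⟩
  · exact ⟨1, one_mem _, 1, one_ne_zero, by simp [flexPoint]⟩
  · simp only at h1 h2
    have hy : y ≠ 0 := by
      rintro rfl
      refine ne_zero_of_divisionPolynomial hd h2 ?_
      rw [← h1]
      norm_num
    obtain ⟨m, hm⟩ : ∃ m, 3 * x ^ 2 + a = -2 * y * m :=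
      ⟨(3 * x ^ 2 + a) / (-2 * y), by field_simp⟩
    -- The flex condition 12 x y^2 = (3x^2 + a)^2 = 4 y^2 m^2 forces this abscissa.
    have hx : x = m ^ 2 / 3 := by
      refine mul_left_cancel₀ (mul_ne_zero (by norm_num : (12 : ℂ) ≠ 0) (pow_ne_zero 2 hy)) ?_
      linear_combination 12 * x * h1 + h2 + (3 * x ^ 2 + a - 2 * y * m) * hm
    have hdet : (flexReflection m (-y)).det ≠ 0 := by
      rw [det_flexReflection (neg_ne_zero.2 hy)]
      norm_num
    refine ⟨Matrix.GeneralLinearGroup.mkOfDetNeZero _ hdet, ?_, 1 / (2 * y), ?_, ?_⟩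
    · refine linSubst_flexReflection (neg_ne_zero.2 hy) ?_ ?_
      · rw [hx] at hm
        linear_combination hm
      · rw [← hx]
        linear_combination -h1
    · simpa using hy
    · change (flexReflection m (-y)).mulVec _ = _
      rw [flexReflection, mulVec_three]
      ext i
      fin_cases i
      · simp [flexPoint]
        rw [hx]
        field_simp
        ring
      · simp [flexPoint]
        field_simp
      · simp [flexPoint]

/-! ### The stabilizer of the flex at infinity -/

/-- The second column is (0, q, 0), so the terms containing y come from (ex + qy + fz)^2 (gx + rz).
They force g = e = f = 0, and the x^2 z coefficient 3p^2 d then gives d = 0. -/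
theorem eq_diagonal_of_mulVec_eq {a b : ℂ} {B : GL (Fin 3) ℂ}
    (hB : B ∈ symmetryGroup (weierstrass a b)) {c : ℂ}
    (hc : (B : Matrix (Fin 3) (Fin 3) ℂ).mulVec ![0, 1, 0] = c • ![0, 1, 0]) :
    ∃ p q r : ℂ, (B : Matrix (Fin 3) (Fin 3) ℂ) = Matrix.diagonal ![p, q, r] ∧
      p ^ 3 = 1 ∧ q ^ 2 * r = 1 ∧ a * p * r ^ 2 = a ∧ b * r ^ 3 = b := by
  have h := linSubst_eq_iff.1 (mem_symmetryGroup.1 hB)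
  obtain ⟨p, k, d, e, q, f, g, l, r, hM⟩ := exists_eq_of_matrix (B : Matrix (Fin 3) (Fin 3) ℂ)
  rw [hM] at hc h ⊢
  rw [mulVec_three] at hc
  have hk : k = 0 := by simpa using congrFun hc 0
  have hl : l = 0 := by simpa using congrFun hc 2
  subst hk hl
  simp only [mulVec_three, eval_weierstrass] at h
  obtain ⟨h0, -, h2, h3, h4, h5, -, h7, h8, h9⟩ := coeff_eq_zero_of_forall_eval
    (c₀ := p ^ 3 + a * p * g ^ 2 + b * g ^ 3 - e ^ 2 * g - 1) (c₁ := -2 * e * q * g)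
    (c₂ := 3 * p ^ 2 * d + a * d * g ^ 2 + 2 * a * p * g * r + 3 * b * g ^ 2 * r - 2 * e * f * g -
      e ^ 2 * r)
    (c₃ := -q ^ 2 * g) (c₄ := -2 * q * f * g - 2 * e * q * r)
    (c₅ := 3 * p * d ^ 2 + a * p * r ^ 2 + 2 * a * d * g * r + 3 * b * g * r ^ 2 - f ^ 2 * g -
      2 * e * f * r - a)
    (c₆ := 0) (c₇ := 1 - q ^ 2 * r) (c₈ := -2 * q * f * r)
    (c₉ := d ^ 3 + a * d * r ^ 2 + b * r ^ 3 - f ^ 2 * r - b)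
    fun x y z => by linear_combination h x y z
  have hqr : q ^ 2 * r = 1 := by linear_combination -h7
  have hq : q ≠ 0 := by
    rintro rfl
    simp at hqr
  have hr : r ≠ 0 := by
    rintro rfl
    simp at hqr
  have hg : g = 0 := by simpa [hq] using h3
  subst hg
  have he : e = 0 := by simpa [hq, hr] using h4
  subst he
  have hf : f = 0 := by simpa [hq, hr] using h8
  subst hf
  have hp : p ^ 3 = 1 := by linear_combination h0
  have hp0 : p ≠ 0 := by
    rintro rfl
    simp at hp
  have hd : d = 0 := by simpa [hp0] using h2
  subst hd
  refine ⟨p, q, r, ?_, hp, hqr, by linear_combination h5, by linear_combination h9⟩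
  ext i j
  fin_cases i <;> fin_cases j <;> simp

theorem linSubst_diagonal_weierstrass {a b p q r : ℂ} (hp : p ^ 3 = 1) (hq : q ^ 2 * r = 1)
    (ha : a * p * r ^ 2 = a) (hb : b * r ^ 3 = b) :
    linSubst (Matrix.diagonal ![p, q, r]) (weierstrass a b) = weierstrass a b := by
  refine linSubst_eq_iff.2 fun x y z => ?_
  have : (Matrix.diagonal ![p, q, r]).mulVec ![x, y, z] = ![p * x, q * y, r * z] := by
    ext i
    fin_cases i <;> simp [Matrix.mulVec_diagonal]
  rw [this, eval_weierstrass, eval_weierstrass]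
  linear_combination x ^ 3 * hp - y ^ 2 * z * hq + x * z ^ 2 * ha + z ^ 3 * hb

/-- Parameters of the symmetries of a cubic in Weierstrass form that fix the flex at infinity. -/
def stabilizerParams (a b : ℂ) : Set (ℂˣ × ℂˣ) :=
  {t | (t.1 : ℂ) ^ 3 = 1 ∧ a * t.1 = a * t.2 ^ 4 ∧ b = b * t.2 ^ 6}

/-- The symmetry of a cubic in Weierstrass form with the given parameters. -/
def stabilizerMatrix (t : ℂˣ × ℂˣ) : GL (Fin 3) ℂ :=
  Matrix.GeneralLinearGroup.mkOfDetNeZero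
    (Matrix.diagonal ![(t.1 : ℂ), t.2, 1 / (t.2 : ℂ) ^ 2]) (by
      simp [Fin.prod_univ_three])

theorem stabilizerMatrix_coe (t : ℂˣ × ℂˣ) :
    (stabilizerMatrix t : Matrix (Fin 3) (Fin 3) ℂ) =
      Matrix.diagonal ![(t.1 : ℂ), t.2, 1 / (t.2 : ℂ) ^ 2] :=
  rfl

theorem stabilizerMatrix_injective : Function.Injective stabilizerMatrix := by
  intro s t h
  have hM := congrArg (fun B : GL (Fin 3) ℂ => (B : Matrix (Fin 3) (Fin 3) ℂ)) h
  simp only [stabilizerMatrix_coe] at hM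
  have h0 := congrFun (Matrix.diagonal_injective hM) 0
  have h1 := congrFun (Matrix.diagonal_injective hM) 1
  exact Prod.ext (Units.ext (by simpa using h0)) (Units.ext (by simpa using h1))

theorem stabilizerMatrix_mulVec (t : ℂˣ × ℂˣ) :
    (stabilizerMatrix t : Matrix (Fin 3) (Fin 3) ℂ).mulVec ![0, 1, 0] =
      (t.2 : ℂ) • ![0, 1, 0] := by
  rw [stabilizerMatrix_coe]
  ext i
  fin_cases i <;> simp [Matrix.mulVec_diagonal]

theorem stabilizerMatrix_mem {a b : ℂ} {t : ℂˣ × ℂˣ} (ht : t ∈ stabilizerParams a b) :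
    stabilizerMatrix t ∈ symmetryGroup (weierstrass a b) := by
  obtain ⟨h1, h2, h3⟩ := ht
  obtain ⟨p, q⟩ := t
  simp only at h1 h2 h3
  have hq := Units.ne_zero q
  rw [mem_symmetryGroup, stabilizerMatrix_coe]
  refine linSubst_diagonal_weierstrass h1 ?_ ?_ ?_
  · field_simp
  · field_simp
    linear_combination h2
  · field_simp
    linear_combination h3

theorem exists_eq_stabilizerMatrix {a b : ℂ} {B : GL (Fin 3) ℂ}
    (hB : B ∈ symmetryGroup (weierstrass a b)) {c : ℂ}
    (hc : (B : Matrix (Fin 3) (Fin 3) ℂ).mulVec ![0, 1, 0] = c • ![0, 1, 0]) :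
    ∃ t ∈ stabilizerParams a b, B = stabilizerMatrix t := by
  obtain ⟨p, q, r, hM, hp, hq, ha, hb⟩ := eq_diagonal_of_mulVec_eq hB hc
  have hp0 : p ≠ 0 := by
    rintro rfl
    simp at hp
  have hq0 : q ≠ 0 := by
    rintro rfl
    simp at hq
  obtain rfl : r = 1 / q ^ 2 := by
    field_simp
    linear_combination hq
  refine ⟨(Units.mk0 p hp0, Units.mk0 q hq0), ⟨hp, ?_, ?_⟩, Units.ext hM⟩
  · field_simp at ha
    simp only [Units.val_mk0]
    linear_combination ha
  · field_simp at hb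
    simp only [Units.val_mk0]
    linear_combination hb

/-- This is orbit-stabilizer for the transitive action on the nine flexes: each symmetry is uniquely
T P times an element of the stabilizer of infinity, where P is the image of infinity. -/
theorem card_symmetryGroup_weierstrass {a b : ℂ} (hd : 4 * a ^ 3 + 27 * b ^ 2 ≠ 0) :
    Nat.card (symmetryGroup (weierstrass a b)) = 9 * Nat.card (stabilizerParams a b) := by
  choose T hT k hk hTk using exists_mem_symmetryGroup_mulVec_eq_flexPoint hd
  rw [← card_option_affineFlexes hd, ← Nat.card_prod]
  symm
  have hmul : ∀ P t, ((T P * stabilizerMatrix t : GL (Fin 3) ℂ) :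
      Matrix (Fin 3) (Fin 3) ℂ).mulVec ![0, 1, 0] = ((t.2 : ℂ) * k P) • flexPoint P := by
    intro P t
    rw [Units.val_mul, ← Matrix.mulVec_mulVec, stabilizerMatrix_mulVec, Matrix.mulVec_smul, hTk,
      smul_smul]
  refine Nat.card_eq_of_bijective (fun s => ⟨T s.1 * stabilizerMatrix s.2.1,
    mul_mem (hT _) (stabilizerMatrix_mem s.2.2)⟩) ⟨?_, ?_⟩
  · rintro ⟨P, t, ht⟩ ⟨Q, u, hu⟩ h
    have h' : T P * stabilizerMatrix t = T Q * stabilizerMatrix u := congrArg Subtype.val h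
    have hPQ : P = Q := by
      have h1 := hmul P t
      rw [h', hmul] at h1
      have h2 : (t.2 : ℂ) * k P ≠ 0 := mul_ne_zero t.2.ne_zero (hk P)
      have h3 : (u.2 : ℂ) * k Q ≠ 0 := mul_ne_zero u.2.ne_zero (hk Q)
      refine flexPoint_injective (mul_ne_zero (inv_ne_zero h2) h3) ?_
      rw [← smul_smul, h1, smul_smul, inv_mul_cancel₀ h2, one_smul]
    subst hPQ
    have htu : t = u := stabilizerMatrix_injective (mul_left_cancel h')
    subst htu
    rfl
  · rintro ⟨B, hB⟩
    obtain ⟨P, c, hc, hP⟩ := ((isFlexLine_weierstrass a b).mulVec hB).exists_eq_flexPoint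
    obtain ⟨t, ht, h⟩ := exists_eq_stabilizerMatrix (c := (k P)⁻¹ * c)
      (mul_mem (inv_mem (hT P)) hB) (by
        have h1 : ((T P)⁻¹ : GL (Fin 3) ℂ).1.mulVec (flexPoint P) = (k P)⁻¹ • ![0, 1, 0] := by
          have h2 : flexPoint P =
              (k P)⁻¹ • (T P : Matrix (Fin 3) (Fin 3) ℂ).mulVec ![0, 1, 0] := by
            rw [hTk, smul_smul, inv_mul_cancel₀ (hk P), one_smul]
          rw [h2, Matrix.mulVec_smul, Matrix.mulVec_mulVec, Units.inv_mul, Matrix.one_mulVec]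
        rw [Units.val_mul, ← Matrix.mulVec_mulVec, hP, Matrix.mulVec_smul, h1, smul_smul,
          mul_comm])
    refine ⟨(P, ⟨t, ht⟩), Subtype.ext ?_⟩
    change T P * stabilizerMatrix t = B
    rw [← h, mul_inv_cancel_left]

theorem Equivalent.card_projectiveSymmetryGroup {F : Poly} {a b : ℂ}
    (hd : 4 * a ^ 3 + 27 * b ^ 2 ≠ 0) (h : Equivalent F (weierstrass a b)) :
    Nat.card (projectiveSymmetryGroup F) = 3 * Nat.card (stabilizerParams a b) := by
  have h1 := card_symmetryGroup_weierstrass hd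
  rw [weierstrass_eq_cubic] at h
  have h2 := h.card_symmetryGroup_eq_three_mul rfl
  rw [← weierstrass_eq_cubic] at h2
  omega

/-! ### Orders of the stabilizers -/

theorem mem_stabilizerParams {a b : ℂ} {t : ℂˣ × ℂˣ} :
    t ∈ stabilizerParams a b ↔ t.1 ^ 3 = 1 ∧ (a = 0 ∨ t.1 = t.2 ^ 4) ∧ (b = 0 ∨ t.2 ^ 6 = 1) := by
  simp only [stabilizerParams, Set.mem_ofPred_eq, Units.ext_iff, Units.val_pow_eq_pow_val,
    Units.val_one]
  refine and_congr_right fun _ => and_congr ?_ ?_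
  · rw [mul_eq_mul_left_iff, or_comm]
  · constructor
    · intro h
      by_cases hb : b = 0
      · exact Or.inl hb
      · exact Or.inr (mul_left_cancel₀ hb (by rw [mul_one, ← h]))
    · rintro (rfl | h)
      · rw [zero_mul]
      · rw [h, mul_one]

/-- Here p = q^4 with q^6 = 1, and p^3 = q^12 = 1 is automatic. -/
theorem card_stabilizerParams_of_ne_zero {a b : ℂ} (ha : a ≠ 0) (hb : b ≠ 0) :
    Nat.card (stabilizerParams a b) = 6 := by
  refine Eq.trans (Eq.symm ?_) (Complex.card_rootsOfUnity 6)
  refine Nat.card_eq_of_bijective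
    (fun u : rootsOfUnity 6 ℂ => ⟨((u : ℂˣ) ^ 4, (u : ℂˣ)), ?_⟩) ⟨?_, ?_⟩
  · have hu : (u : ℂˣ) ^ 6 = 1 := (mem_rootsOfUnity _ _).1 u.2
    refine mem_stabilizerParams.2 ⟨?_, Or.inr rfl, Or.inr hu⟩
    rw [← pow_mul, pow_mul _ 6 2, hu, one_pow]
  · intro u v h
    exact Subtype.ext (congrArg (fun t : stabilizerParams a b => t.1.2) h)
  · rintro ⟨⟨p, q⟩, h⟩
    obtain ⟨-, h2, h3⟩ := mem_stabilizerParams.1 h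
    obtain rfl : p = q ^ 4 := by simpa [ha] using h2
    exact ⟨⟨q, (mem_rootsOfUnity _ _).2 (by simpa [hb] using h3)⟩, rfl⟩

/-- Without the condition q^6 = 1, the equations p = q^4 and p^3 = 1 leave q^12 = 1. -/
theorem card_stabilizerParams_zero_right {a : ℂ} (ha : a ≠ 0) :
    Nat.card (stabilizerParams a 0) = 12 := by
  refine Eq.trans (Eq.symm ?_) (Complex.card_rootsOfUnity 12)
  refine Nat.card_eq_of_bijective
    (fun u : rootsOfUnity 12 ℂ => ⟨((u : ℂˣ) ^ 4, (u : ℂˣ)), ?_⟩) ⟨?_, ?_⟩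
  · have hu : (u : ℂˣ) ^ 12 = 1 := (mem_rootsOfUnity _ _).1 u.2
    refine mem_stabilizerParams.2 ⟨?_, Or.inr rfl, Or.inl rfl⟩
    rw [← pow_mul, hu]
  · intro u v h
    exact Subtype.ext (congrArg (fun t : stabilizerParams a 0 => t.1.2) h)
  · rintro ⟨⟨p, q⟩, h⟩
    obtain ⟨h1, h2, -⟩ := mem_stabilizerParams.1 h
    obtain rfl : p = q ^ 4 := by simpa [ha] using h2
    exact ⟨⟨q, (mem_rootsOfUnity _ _).2 (by simpa [← pow_mul] using h1)⟩, rfl⟩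

/-- Without the condition p = q^4, the cube root p and the sixth root q are independent. -/
theorem card_stabilizerParams_zero_left {b : ℂ} (hb : b ≠ 0) :
    Nat.card (stabilizerParams 0 b) = 18 := by
  have hcard : Nat.card (rootsOfUnity 3 ℂ × rootsOfUnity 6 ℂ) = 18 := by
    rw [Nat.card_prod, Complex.card_rootsOfUnity, Complex.card_rootsOfUnity]
  refine Eq.trans (Eq.symm ?_) hcard
  refine Nat.card_eq_of_bijective
    (fun u : rootsOfUnity 3 ℂ × rootsOfUnity 6 ℂ => ⟨((u.1 : ℂˣ), (u.2 : ℂˣ)), ?_⟩) ⟨?_, ?_⟩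
  · exact mem_stabilizerParams.2 ⟨(mem_rootsOfUnity _ _).1 u.1.2, Or.inl rfl,
      Or.inr ((mem_rootsOfUnity _ _).1 u.2.2)⟩
  · intro u v h
    exact Prod.ext (Subtype.ext (congrArg (fun t : stabilizerParams 0 b => t.1.1) h))
      (Subtype.ext (congrArg (fun t : stabilizerParams 0 b => t.1.2) h))
  · rintro ⟨⟨p, q⟩, h⟩
    obtain ⟨h1, -, h3⟩ := mem_stabilizerParams.1 h
    exact ⟨(⟨p, (mem_rootsOfUnity _ _).2 h1⟩,
      ⟨q, (mem_rootsOfUnity _ _).2 (by simpa [hb] using h3)⟩), rfl⟩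

end TernaryCubic

end

theorem mainTheorem2 :
    -- the classification
    (∀ F : TernaryCubic.Poly, F.IsHomogeneous 3 → Irreducible F →
      (TernaryCubic.IsSingular F ↔
        TernaryCubic.Equivalent F TernaryCubic.cusp ∨
        TernaryCubic.Equivalent F TernaryCubic.node) ∧
      (¬ TernaryCubic.IsSingular F ↔
        (∃ a : ℂ, a ≠ 0 ∧ 4 * a ^ 3 + 27 ≠ 0 ∧
          TernaryCubic.Equivalent F (TernaryCubic.weierstrass a 1)) ∨
        TernaryCubic.Equivalent F (TernaryCubic.weierstrass 1 0) ∨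
        TernaryCubic.Equivalent F (TernaryCubic.weierstrass 0 1))) ∧
    -- the symmetries of the cusp
    (∀ (F : TernaryCubic.Poly) (A : GL (Fin 3) ℂ),
      TernaryCubic.cusp = TernaryCubic.linSubst (A : Matrix (Fin 3) (Fin 3) ℂ) F →
        TernaryCubic.symmetryDim F = 1 ∧
        TernaryCubic.projectiveSymmetryGroup F =
          (TernaryCubic.cuspGroup.map (MulAut.conj A).toMonoidHom).map
            TernaryCubic.projection ∧
        (∀ B : GL (Fin 3) ℂ, B ∈ TernaryCubic.symmetryGroup F ↔
          ∃ ω : ℂ, ω ^ 3 = 1 ∧ ∃ D ∈ TernaryCubic.cuspGroup,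
            (B : Matrix (Fin 3) (Fin 3) ℂ) =
              ω • ((A * D * A⁻¹ : GL (Fin 3) ℂ) : Matrix (Fin 3) (Fin 3) ℂ))) ∧
    -- the symmetries of the node
    (∀ F : TernaryCubic.Poly, TernaryCubic.Equivalent F TernaryCubic.node →
      Nat.card (TernaryCubic.projectiveSymmetryGroup F) = 6 ∧
      Nat.card (TernaryCubic.symmetryGroup F) = 18) ∧
    -- the symmetries of the nonsingular cubics
    (∀ (F : TernaryCubic.Poly) (a : ℂ), a ≠ 0 → 4 * a ^ 3 + 27 ≠ 0 →
      TernaryCubic.Equivalent F (TernaryCubic.weierstrass a 1) →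
      Nat.card (TernaryCubic.projectiveSymmetryGroup F) = 18) ∧
    (∀ F : TernaryCubic.Poly,
      TernaryCubic.Equivalent F (TernaryCubic.weierstrass 1 0) →
      Nat.card (TernaryCubic.projectiveSymmetryGroup F) = 36) ∧
    (∀ F : TernaryCubic.Poly,
      TernaryCubic.Equivalent F (TernaryCubic.weierstrass 0 1) →
      Nat.card (TernaryCubic.projectiveSymmetryGroup F) = 54) ∧
    TernaryCubic.Equivalent TernaryCubic.fermat (TernaryCubic.weierstrass 0 1) := by
  refine ⟨fun F hF hirr => ?_, fun F A hA => ⟨TernaryCubic.symmetryDim_of_cusp hA,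
    TernaryCubic.projectiveSymmetryGroup_of_cusp hA,
    TernaryCubic.mem_symmetryGroup_iff_of_cusp hA⟩,
    fun F h => TernaryCubic.card_of_equivalent_node h, fun F a ha hd h => ?_, fun F h => ?_,
    fun F h => ?_, TernaryCubic.fermat_equivalent_weierstrass⟩
  · refine ⟨⟨TernaryCubic.equivalent_cusp_or_node hF hirr, ?_⟩,
      ⟨TernaryCubic.equivalent_weierstrass hF hirr, ?_⟩⟩
    · rintro (h | h)
      · exact h.isSingular TernaryCubic.isSingular_cusp
      · exact h.isSingular TernaryCubic.isSingular_node
    · rintro (⟨a, -, hd, h⟩ | h | h)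
      · exact mt h.symm.isSingular
          (TernaryCubic.not_isSingular_weierstrass (by simpa using hd))
      · exact mt h.symm.isSingular (TernaryCubic.not_isSingular_weierstrass (by norm_num))
      · exact mt h.symm.isSingular (TernaryCubic.not_isSingular_weierstrass (by norm_num))
  · rw [h.card_projectiveSymmetryGroup (by simpa using hd),
      TernaryCubic.card_stabilizerParams_of_ne_zero ha one_ne_zero]
  · rw [h.card_projectiveSymmetryGroup (by norm_num),
      TernaryCubic.card_stabilizerParams_zero_right one_ne_zero]
  · rw [h.card_projectiveSymmetryGroup (by norm_num),
      TernaryCubic.card_stabilizerParams_zero_left one_ne_zero]
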